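/- For positive integers $n_1,\dots,n_d$ and $I\subset[d]=\{1,\dots,d\}$ write $\mathbb F_2^{I}=\bigotimes_{i\in I}\mathbb F_2^{n_i}$ and $I^c=[d]\setminus I$. Let $\mathcal G=\mathbb F_2^{n_1}\otimes\cdots\otimes\mathbb F_2^{n_d}$, viewed as the space of all $(n_1,\dots,n_d)$-arrays over $\mathbb F_2$ with the entrywise dot product $r.q$, and let $\mathcal B$ be the multiset $\{u_1\otimes\cdots\otimes u_d : u_i\in\mathbb F_2^{n_i}\text{ for all }i\}$, with one element for each tuple $(u_1,\dots,u_d)$ (so $|\mathcal B|=2^{n_1+\cdots+n_d}$). For a multiset $B$ of elements of $\mathcal G$, let $kB$ be the set of elements of $\mathcal G$ that can be written as a sum of at most $k$ elements of $B$ (repetitions allowed). For a subspace $V\subset\mathbb F_2^I$, regard $V\otimes\mathbb F_2^{I^c}$ as a subspace of $\mathcal G$. **Lemma 2.1.** For all $d\in\mathbb N$ and $\delta>0$ there exist a positive integer $f_1(d)$ and a real number $f_3(d)>0$, both depending only on $d$, and $f_2(d,\delta)\in\mathbb N$, depending only on $d$ and $\delta$, with the following property. Let $n_1,\dots,n_d$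 be positive integers and let $\mathcal B'\subset\mathcal B$ be a sub-multiset with $|\mathcal B'|\ge\delta|\mathcal B|$. Then there exist a multiset $Q$ whose elements are chosen from $f_1(d)\mathcal B'$ (with arbitrary multiplicity) and, for each non-empty $I\subset[d]$, a subspace $V_I\subset\mathbb F_2^I$ of dimension at most $f_2(d,\delta)$, such that every array $r\in\mathcal G$ with $r.q=0$ for at least $(1-f_3(d))|Q|$ choices of $q\in Q$ (counted with multiplicity) belongs to $$\sum_{I\subset[d],\,I\ne\emptyset}V_I\otimes\mathbb F_2^{I^c}.$$ -/

import Mathlib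

namespace GowersJanzer

/-- The arrays over `𝔽₂` whose axes are the elements of `I ⊆ [d]`, the axis `i` having length `n i`.
This is the space `𝔽₂^I = ⨂_{i ∈ I} 𝔽₂^{n i}`, in coordinates. -/
abbrev SubArray {d : ℕ} (n : Fin d → ℕ) (I : Finset (Fin d)) : Type :=
  ((i : I) → Fin (n i)) → ZMod 2

/-- The space `𝒢 = 𝔽₂^{n 1} ⊗ ⋯ ⊗ 𝔽₂^{n d}` of all `d`-dimensional `(n 1, …, n d)`-arrays
over `𝔽₂`. -/
abbrev Arrays {d : ℕ} (n : Fin d → ℕ) : Type :=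
  ((i : Fin d) → Fin (n i)) → ZMod 2

/-- The array `u 1 ⊗ ⋯ ⊗ u d`. -/
def pureTensor {d : ℕ} {n : Fin d → ℕ} (u : (i : Fin d) → Fin (n i) → ZMod 2) : Arrays n :=
  fun x => ∏ i, u i (x i)

/-- The multiset `ℬ` of all `u 1 ⊗ ⋯ ⊗ u d`, one for each tuple `(u 1, …, u d)` of vectors
`u i ∈ 𝔽₂^{n i}` (zero vectors included). -/
def rankOneMultiset {d : ℕ} (n : Fin d → ℕ) : Multiset (Arrays n) :=
  (Finset.univ : Finset ((i : Fin d) → Fin (n i) → ZMod 2)).val.map pureTensor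

/-- The set `kB` of all sums of at most `k` elements of `B`; the summands may repeat. -/
def sumsOfAtMost {G : Type*} [AddCommMonoid G] (k : ℕ) (B : Multiset G) : Set G :=
  {g | ∃ s : Multiset G, s.card ≤ k ∧ (∀ b ∈ s, b ∈ B) ∧ s.sum = g}

/-- The tensor product `v ⊗ w ∈ 𝒢` of `v ∈ 𝔽₂^I` and `w ∈ 𝔽₂^{I^c}`. -/
def tensor {d : ℕ} {n : Fin d → ℕ} {I : Finset (Fin d)} (v : SubArray n I) (w : SubArray n Iᶜ) :
    Arrays n :=
  fun x => v (fun i => x i) * w (fun i => x i)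

/-- The subspace `V ⊗ 𝔽₂^{I^c}` of `𝒢`, for a subspace `V` of `𝔽₂^I`. -/
def tensorFull {d : ℕ} {n : Fin d → ℕ} {I : Finset (Fin d)}
    (V : Submodule (ZMod 2) (SubArray n I)) : Submodule (ZMod 2) (Arrays n) :=
  Submodule.span (ZMod 2) {g | ∃ v ∈ V, ∃ w : SubArray n Iᶜ, tensor v w = g}

end GowersJanzer

/-!
The theorem holds with `f₁ = 1` and `Q = B'`: if an array `r` is orthogonal to all but a small
proportion of a dense set of rank one arrays, then it lies in a degenerate space
`∑ V_I ⊗ 𝔽₂^{I^c}` of bounded size which depends only on the set.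

Arrays are treated as multilinear functions of `u = (u 1, …, u d)`, so that the tensor product is
the pointwise product, and the dense set is replaced by a weight `w` on the tuples `u`. The
statement for `𝔽₂^I` (`MostlyZeroDegenerate I`) is proved by induction on the number of axes.

Fix an axis `i₀` and let `I₀` be the set of the other ones. By induction, for most `y ∈ 𝔽₂^{n i₀}`
the slice of `r` at `y` lies in a degenerate space `X y` that does not depend on `r`. It remains to
find one degenerate space containing all `r` of this kind (`exists_degen_of_most_slices`). For this,
`r` is written modulo a fixed degenerate space as a sum of boundedly many products `v ⊗ b` with
`v ∈ 𝔽₂^T`, `T ⊆ I₀`, and the sets `T` are made larger one at a time, starting from `T = ∅`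
(`exists_degen_replace`). Three facts carry this step.

* An element of `𝔽₂^T` that vanishes on the common zeros in `∏_{i ∈ T} 𝔽₂^{n i}` of the forms
  defining `X y`, for a positive proportion of `y`, lies in a fixed degenerate space
  (`exists_degen_of_vanishing`). So those `v` may be discarded.
* For the other `v`, evaluating at such zeros shows that combinations of the cofactors `b` have
  degenerate slices for many `y`. Since common level sets of boundedly many multilinear functions
  have positive density (`card_level_set`), a pigeonhole argument applies: among many such
  combinations there are two whose difference has, for many `y`, a slice that is a bounded sum of
  proper products, plus a term independent of `y` (`exists_net_of_dense_slices`).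
* Such a difference vanishes identically in some axis `i₁` for a positive proportion of the values
  of the remaining axes, so that the induction hypothesis without `i₁` shows that it is itself a
  sum of boundedly many products with factors on axes other than `i₀`
  (`exists_degen_of_dense_slices`). Multiplied by `v ∈ 𝔽₂^T`, these have larger sets in place
  of `T`.

When only `T = I₀` is left, the cofactors are linear forms on `𝔽₂^{n i₀}`, and only boundedly many
linear forms vanish at most points of a dense set (`card_mostlyZero_linear`).
-/

namespace GowersJanzer

open Finset Function
open scoped Classical

/-- The tuples `(u 1, …, u d)` with `u i ∈ 𝔽₂^{n i}`. -/
abbrev Tup {d : ℕ} (n : Fin d → ℕ) : Type := (i : Fin d) → Fin (n i) → ZMod 2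

/-- The space `𝔽₂^I` realised as the functions of `u = (u 1, …, u d)` that are multilinear in the
`u i` with `i ∈ I` and do not depend on the other `u i`. The tensor product of such functions for
disjoint `I` is then the pointwise product. Over `𝔽₂`, additivity is linearity. -/
def multilin {d : ℕ} (n : Fin d → ℕ) (I : Finset (Fin d)) :
    Submodule (ZMod 2) (Tup n → ZMod 2) where
  carrier := {f | (∀ u u' : Tup n, (∀ i ∈ I, u i = u' i) → f u = f u') ∧
    ∀ i ∈ I, ∀ (u : Tup n) (x y : Fin (n i) → ZMod 2),
      f (update u i (x + y)) = f (update u i x) + f (update u i y)}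
  add_mem' := by
    rintro f g ⟨hf, hf'⟩ ⟨hg, hg'⟩
    refine ⟨fun u u' h => ?_, fun i hi u x y => ?_⟩
    · simp only [Pi.add_apply, hf u u' h, hg u u' h]
    · simp only [Pi.add_apply, hf' i hi, hg' i hi]; ring
  zero_mem' := by simp
  smul_mem' := by
    rintro c f ⟨hf, hf'⟩
    refine ⟨fun u u' h => ?_, fun i hi u x y => ?_⟩
    · simp only [Pi.smul_apply, hf u u' h]
    · simp only [Pi.smul_apply, hf' i hi, smul_add]

/-- A function on `Tup n` together with the set of axes on which it is meant to depend. -/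
abbrev Form {d : ℕ} (n : Fin d → ℕ) : Type := Finset (Fin d) × (Tup n → ZMod 2)

/-- The space `∑_{(J, g) ∈ G} g ⊗ 𝔽₂^{I \ J}`. A subspace `∑_J V_J ⊗ 𝔽₂^{I \ J}` is encoded by
listing spanning sets of all the `V_J` in one finite set `G`, whose size replaces the
dimensions. -/
def degen {d : ℕ} {n : Fin d → ℕ} (I : Finset (Fin d)) (G : Finset (Form n)) :
    Submodule (ZMod 2) (Tup n → ZMod 2) :=
  ⨆ g ∈ G, (multilin n (I \ g.1)).map (LinearMap.mulLeft (ZMod 2) g.2)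

/-- Every member of `G` is an element of `𝔽₂^J` with `∅ ≠ J ⊆ I`. -/
def Valid {d : ℕ} {n : Fin d → ℕ} (I : Finset (Fin d)) (G : Finset (Form n)) : Prop :=
  ∀ g ∈ G, g.1 ⊆ I ∧ g.1.Nonempty ∧ g.2 ∈ multilin n g.1

variable {d : ℕ} {n : Fin d → ℕ} {I J K T A : Finset (Fin d)}

/-! ### Multilinear functions -/

lemma multilin_congr {f : Tup n → ZMod 2} (hf : f ∈ multilin n I) {u u' : Tup n}
    (h : ∀ i ∈ I, u i = u' i) : f u = f u' := hf.1 u u' h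

lemma multilin_update_add {f : Tup n → ZMod 2} (hf : f ∈ multilin n I) {i : Fin d} (hi : i ∈ I)
    (u : Tup n) (x y : Fin (n i) → ZMod 2) :
    f (update u i (x + y)) = f (update u i x) + f (update u i y) := hf.2 i hi u x y

lemma multilin_update_of_notMem {f : Tup n → ZMod 2} (hf : f ∈ multilin n I) {i : Fin d}
    (hi : i ∉ I) (u : Tup n) (x : Fin (n i) → ZMod 2) : f (update u i x) = f u :=
  multilin_congr hf fun j hj => update_of_ne (fun h => hi (by rwa [← h])) x u

lemma multilin_update_zero {f : Tup n → ZMod 2} (hf : f ∈ multilin n I) {i : Fin d} (hi : i ∈ I)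
    (u : Tup n) : f (update u i 0) = 0 := by
  have h := multilin_update_add hf hi u 0 0
  rwa [add_zero, left_eq_add] at h

lemma multilin_zero {f : Tup n → ZMod 2} (hf : f ∈ multilin n I) (hI : I.Nonempty) : f 0 = 0 := by
  obtain ⟨i, hi⟩ := hI
  simpa using multilin_update_zero hf hi 0

lemma one_mem_multilin : (1 : Tup n → ZMod 2) ∈ multilin n ∅ := ⟨by simp, by simp⟩

lemma mul_mem_multilin {f g : Tup n → ZMod 2} (hf : f ∈ multilin n I) (hg : g ∈ multilin n J)
    (hIJ : Disjoint I J) : f * g ∈ multilin n (I ∪ J) := by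
  refine ⟨fun u u' h => ?_, fun i hi u x y => ?_⟩
  · rw [Pi.mul_apply, Pi.mul_apply,
      multilin_congr hf fun i hi => h i (mem_union_left _ hi),
      multilin_congr hg fun i hi => h i (mem_union_right _ hi)]
  · simp only [Pi.mul_apply]
    rcases mem_union.1 hi with hi | hi
    · have := disjoint_left.1 hIJ hi
      simp only [multilin_update_of_notMem hg this, multilin_update_add hf hi, add_mul]
    · have := disjoint_right.1 hIJ hi
      simp only [multilin_update_of_notMem hf this, multilin_update_add hg hi, mul_add]

/-- The function obtained from `f` by substituting `u` in the axes of `A`. -/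
def restrict (A : Finset (Fin d)) (u : Tup n) :
    (Tup n → ZMod 2) →ₗ[ZMod 2] (Tup n → ZMod 2) where
  toFun f := fun t => f (A.piecewise u t)
  map_add' _ _ := rfl
  map_smul' _ _ := rfl

lemma restrict_apply (u : Tup n) (f : Tup n → ZMod 2) (t : Tup n) :
    restrict A u f t = f (A.piecewise u t) := rfl

lemma restrict_mul (u : Tup n) (f g : Tup n → ZMod 2) :
    restrict A u (f * g) = restrict A u f * restrict A u g := rfl

lemma restrict_mem {f : Tup n → ZMod 2} (hf : f ∈ multilin n I) (A : Finset (Fin d)) (u : Tup n) :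
    restrict A u f ∈ multilin n (I \ A) := by
  refine ⟨fun t t' h => ?_, fun i hi t x y => ?_⟩
  · refine multilin_congr hf fun i hi => ?_
    by_cases hA : i ∈ A
    · simp [hA]
    · simp [hA, h i (mem_sdiff.2 ⟨hi, hA⟩)]
  · obtain ⟨hi, hA⟩ := mem_sdiff.1 hi
    simp only [restrict_apply]
    have key : ∀ z, A.piecewise u (update t i z) = update (A.piecewise u t) i z := fun z =>
      (update_piecewise_of_notMem (s := A) (f := u) (g := t) hA z).symm
    rw [key, key, key, multilin_update_add hf hi]

lemma restrict_of_disjoint {f : Tup n → ZMod 2} (hf : f ∈ multilin n I) (h : Disjoint I A)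
    (u : Tup n) : restrict A u f = f := by
  funext t
  exact multilin_congr hf fun i hi => by simp [disjoint_left.1 h hi]

lemma restrict_of_subset {f : Tup n → ZMod 2} (hf : f ∈ multilin n I) (h : I ⊆ A)
    (u : Tup n) : restrict A u f = fun _ => f u := by
  funext t
  exact multilin_congr hf fun i hi => by simp [h hi]

lemma restrict_congr {u u' : Tup n} (h : ∀ i ∈ A, u i = u' i) (f : Tup n → ZMod 2) :
    restrict A u f = restrict A u' f := by
  funext t
  simp only [restrict_apply]
  refine congrArg f (funext fun i => ?_)
  by_cases hi : i ∈ A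
  · simp [hi, h i hi]
  · simp [hi]

lemma restrict_singleton (i : Fin d) (u : Tup n) (f : Tup n → ZMod 2) (t : Tup n) :
    restrict {i} u f t = f (update t i (u i)) := by
  rw [restrict_apply, piecewise_singleton]

/-! ### Degenerate spaces -/

lemma mem_degen_iff {G : Finset (Form n)} {f : Tup n → ZMod 2} :
    f ∈ degen I G ↔ ∃ h : Form n → Tup n → ZMod 2,
      (∀ g, h g ∈ multilin n (I \ g.1)) ∧ f = ∑ g ∈ G, g.2 * h g := by
  unfold degen
  rw [Submodule.mem_iSup_finset_iff_exists_sum]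
  constructor
  · rintro ⟨μ, rfl⟩
    choose h hh hh' using fun g => Submodule.mem_map.1 (μ g).2
    exact ⟨h, hh, sum_congr rfl fun g _ => (hh' g).symm⟩
  · rintro ⟨h, hh, rfl⟩
    exact ⟨fun g => ⟨g.2 * h g, Submodule.mem_map.2 ⟨h g, hh g, rfl⟩⟩, rfl⟩

lemma mul_mem_degen {G : Finset (Form n)} {g : Form n} (hg : g ∈ G) {h : Tup n → ZMod 2}
    (hh : h ∈ multilin n (I \ g.1)) : g.2 * h ∈ degen I G :=
  Submodule.mem_iSup_of_mem g <| Submodule.mem_iSup_of_mem hg ⟨h, hh, rfl⟩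

lemma degen_le {G : Finset (Form n)} {M : Submodule (ZMod 2) (Tup n → ZMod 2)}
    (h : ∀ g ∈ G, ∀ b ∈ multilin n (I \ g.1), g.2 * b ∈ M) : degen I G ≤ M := by
  refine iSup₂_le fun g hg => ?_
  rintro _ ⟨b, hb, rfl⟩
  exact h g hg b hb

lemma degen_mono {G G' : Finset (Form n)} (h : G ⊆ G') : degen I G ≤ degen I G' :=
  degen_le fun _ hg _ hb => mul_mem_degen (h hg) hb

lemma degen_union (G G' : Finset (Form n)) : degen I (G ∪ G') = degen I G ⊔ degen I G' := by
  apply le_antisymm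
  · refine degen_le fun g hg b hb => ?_
    rcases mem_union.1 hg with hg | hg
    · exact Submodule.mem_sup_left (mul_mem_degen hg hb)
    · exact Submodule.mem_sup_right (mul_mem_degen hg hb)
  · exact sup_le (degen_mono subset_union_left) (degen_mono subset_union_right)

lemma Valid.union {G G' : Finset (Form n)} (h : Valid I G) (h' : Valid I G') :
    Valid I (G ∪ G') := fun g hg => (mem_union.1 hg).elim (h g) (h' g)

lemma Valid.mono_left {G : Finset (Form n)} (h : Valid I G) (hIJ : I ⊆ J) : Valid J G :=
  fun g hg => ⟨(h g hg).1.trans hIJ, (h g hg).2⟩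

lemma apply_eq_zero_of_mem_degen {G : Finset (Form n)} {f : Tup n → ZMod 2} (hf : f ∈ degen I G)
    {u : Tup n} (hu : ∀ g ∈ G, g.2 u = 0) : f u = 0 := by
  obtain ⟨h, -, rfl⟩ := mem_degen_iff.1 hf
  rw [Finset.sum_apply]
  exact sum_eq_zero fun g hg => by simp [hu g hg]

/-- The effect on a family of forms of substituting `u` in the axes of `A`; the forms that become
constant are dropped. -/
noncomputable def restrictForms (A : Finset (Fin d)) (u : Tup n) (G : Finset (Form n)) :
    Finset (Form n) :=
  (G.filter fun g => ¬ g.1 ⊆ A).image fun g => (g.1 \ A, restrict A u g.2)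

lemma card_restrictForms_le (u : Tup n) (G : Finset (Form n)) :
    (restrictForms A u G).card ≤ G.card :=
  card_image_le.trans (card_filter_le _ _)

lemma restrictForms_congr {u u' : Tup n} (h : ∀ i ∈ A, u i = u' i) (G : Finset (Form n)) :
    restrictForms A u G = restrictForms A u' G := by
  unfold restrictForms
  exact image_congr fun g _ => by simp only [restrict_congr h]

lemma Valid.restrictForms {G : Finset (Form n)}
    (hG : ∀ g ∈ G, g.1 ⊆ I ∧ g.2 ∈ multilin n g.1) (u : Tup n) :
    Valid (I \ A) (restrictForms A u G) := by
  intro g' hg'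
  obtain ⟨g, hg, rfl⟩ := mem_image.1 hg'
  obtain ⟨hg, hA⟩ := mem_filter.1 hg
  exact ⟨sdiff_subset_sdiff (hG g hg).1 subset_rfl, sdiff_nonempty.2 hA,
    restrict_mem (hG g hg).2 A u⟩

lemma restrict_mem_degen {G : Finset (Form n)} (hG : ∀ g ∈ G, g.2 ∈ multilin n g.1)
    {u : Tup n} (hu : ∀ g ∈ G, g.1 ⊆ A → g.2 u = 0) {f : Tup n → ZMod 2} (hf : f ∈ degen I G) :
    restrict A u f ∈ degen (I \ A) (restrictForms A u G) := by
  suffices degen I G ≤ (degen (I \ A) (restrictForms A u G)).comap (restrict A u) from this hf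
  refine degen_le fun g hg b hb => ?_
  rw [Submodule.mem_comap, restrict_mul]
  by_cases hA : g.1 ⊆ A
  · rw [restrict_of_subset (hG g hg) hA, hu g hg hA]
    convert Submodule.zero_mem _
    funext t; simp
  · refine mul_mem_degen (g := (g.1 \ A, restrict A u g.2))
      (mem_image.2 ⟨g, mem_filter.2 ⟨hg, hA⟩, rfl⟩) ?_
    convert restrict_mem hb A u using 2
    ext i; simp only [mem_sdiff]; tauto

lemma degen_mul_mem {G : Finset (Form n)} (hG : Valid T G) (hT : T ⊆ I) {f b : Tup n → ZMod 2}
    (hf : f ∈ degen T G) (hb : b ∈ multilin n (I \ T)) : f * b ∈ degen I G := by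
  suffices degen T G ≤ (degen I G).comap (LinearMap.mulRight (ZMod 2) b) from this hf
  refine degen_le fun g hg c hc => ?_
  rw [Submodule.mem_comap, LinearMap.mulRight_apply, mul_assoc]
  refine mul_mem_degen hg ?_
  convert mul_mem_multilin hc hb (disjoint_of_subset_left sdiff_subset disjoint_sdiff) using 2
  have := (hG g hg).1
  ext i; simp only [mem_sdiff, mem_union]
  constructor
  · rintro ⟨h1, h2⟩; tauto
  · rintro (h | h)
    · exact ⟨hT h.1, h.2⟩
    · exact ⟨h.1, fun h' => h.2 (this h')⟩

/-- The products of `v ∈ 𝔽₂^T` with the members of `H`. -/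
noncomputable def mulForms (T : Finset (Fin d)) (v : Tup n → ZMod 2) (H : Finset (Form n)) :
    Finset (Form n) :=
  H.image fun h => (T ∪ h.1, v * h.2)

lemma mul_degen_mem {H : Finset (Form n)} {v f : Tup n → ZMod 2} (hf : f ∈ degen (I \ T) H) :
    v * f ∈ degen I (mulForms T v H) := by
  obtain ⟨b, hb, rfl⟩ := mem_degen_iff.1 hf
  rw [mul_sum]
  refine Submodule.sum_mem _ fun g hg => ?_
  have hg' : (T ∪ g.1, v * g.2) ∈ mulForms T v H := mem_image.2 ⟨g, hg, rfl⟩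
  have hb' : b g ∈ multilin n (I \ (T ∪ g.1)) := by
    have e : I \ (T ∪ g.1) = (I \ T) \ g.1 := by
      ext i; simp only [mem_sdiff, mem_union]; tauto
    rw [e]; exact hb g
  have key := mul_mem_degen (I := I) hg' hb'
  rwa [mul_assoc] at key

/-! ### Density of common level sets -/

/-- Exchanging `u i` with an independent `x ∈ 𝔽₂^{n i}` preserves the uniform measure on
pairs. -/
lemma sum_sum_update {M : Type*} [AddCommMonoid M] (i : Fin d)
    (F : Tup n → (Fin (n i) → ZMod 2) → M) :
    ∑ x, ∑ u, F (update u i x) (u i) = ∑ x, ∑ u, F u x := by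
  let e : (Fin (n i) → ZMod 2) × Tup n ≃ (Fin (n i) → ZMod 2) × Tup n :=
    ⟨fun p => (p.2 i, update p.2 i p.1), fun p => (p.2 i, update p.2 i p.1),
      fun p => by simp, fun p => by simp⟩
  have h₁ := Fintype.sum_prod_type (fun p : (Fin (n i) → ZMod 2) × Tup n =>
    F (update p.2 i p.1) (p.2 i))
  have h₂ := Fintype.sum_prod_type (fun p : (Fin (n i) → ZMod 2) × Tup n => F p.2 p.1)
  exact h₁.symm.trans ((Fintype.sum_equiv e _ _ fun p => rfl).trans h₂)

lemma sum_sum_update' {M : Type*} [AddCommMonoid M] (i : Fin d) (F : Tup n → M) :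
    ∑ x, ∑ u, F (update u i x) = Fintype.card (Fin (n i) → ZMod 2) • ∑ u, F u := by
  rw [sum_sum_update i (fun u _ => F u), sum_const, card_univ]

/-- A coset of the common kernel of `#G` additive maps to `𝔽₂` has codimension at most `#G`. -/
lemma card_fiber_update (G : Finset (Tup n → ZMod 2)) (hG : ∀ g ∈ G, ∃ J, g ∈ multilin n J)
    (i : Fin d) (u : Tup n) :
    Fintype.card (Fin (n i) → ZMod 2) ≤
      (univ.filter fun x => ∀ g ∈ G, g (update u i x) = g u).card * 2 ^ G.card := by
  have hle : (univ : Finset (Fin (n i) → ZMod 2)).card ≤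
      (univ.filter fun x => ∀ g ∈ G, g (update u i x) = g u).card *
        (univ : Finset (G → ZMod 2)).card := by
    refine card_le_mul_card_image_of_maps_to
      (f := fun (x : Fin (n i) → ZMod 2) (g : G) => g.1 (update u i x))
      (fun x _ => mem_univ _) _ fun c _ => ?_
    rcases (univ.filter fun x : Fin (n i) → ZMod 2 =>
      (fun g : G => g.1 (update u i x)) = c).eq_empty_or_nonempty with h | ⟨x₀, hx₀⟩
    · rw [h]; simp
    -- translation by `u i - x₀` moves the fibre over `c` into the fibre of `u`
    refine card_le_card_of_injOn (fun x => x + (x₀ + u i)) (fun x hx => ?_)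
      fun x _ y _ h => by simpa using h
    simp only [coe_filter, mem_univ, true_and, Set.mem_ofPred_eq, mem_filter] at hx hx₀ ⊢
    intro g hg
    have h₁ := congrFun (hx.trans hx₀.symm) ⟨g, hg⟩
    simp only at h₁
    obtain ⟨J, hJ⟩ := hG g hg
    by_cases hi : i ∈ J
    · rw [multilin_update_add hJ hi, multilin_update_add hJ hi, h₁, ← add_assoc,
        CharTwo.add_self_eq_zero, zero_add, update_eq_self]
    · rw [multilin_update_of_notMem hJ hi]
  simpa using hle

/-- Common level sets of `#G` multilinear functions have density at least `2^{-#G d}`, if they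
are non-empty: starting from the point `u₀`, the axes are freed one by one. -/
lemma card_level_set (G : Finset (Tup n → ZMod 2)) (hG : ∀ g ∈ G, ∃ J, g ∈ multilin n J)
    (u₀ : Tup n) :
    Fintype.card (Tup n) ≤ (univ.filter fun u => ∀ g ∈ G, g u = g u₀).card * 2 ^ (G.card * d) := by
  suffices H : ∀ (T : Finset (Fin d)) (u₀ : Tup n), Fintype.card (Tup n) ≤
      (univ.filter fun u => ∀ g ∈ G, g (T.piecewise u u₀) = g u₀).card * 2 ^ (G.card * T.card) by
    simpa using H univ u₀
  intro T
  induction T using Finset.induction_on with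
  | empty => intro u₀; simp
  | insert i T hi ih =>
    intro u₀
    have hpw : ∀ (u v : Tup n) (x : Fin (n i) → ZMod 2),
        (insert i T).piecewise (update u i x) v = T.piecewise u (update v i x) := by
      intro u v x
      funext j
      by_cases hj : j = i
      · subst hj; simp [hi]
      · by_cases hjT : j ∈ T <;> simp [hj, hjT]
    set S := univ.filter fun u : Tup n => ∀ g ∈ G, g ((insert i T).piecewise u u₀) = g u₀ with hS
    set N := Fintype.card (Tup n)
    set D := Fintype.card (Fin (n i) → ZMod 2)
    set X := univ.filter fun x : Fin (n i) → ZMod 2 => ∀ g ∈ G, g (update u₀ i x) = g u₀ with hX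
    have hD : 0 < D := Fintype.card_pos
    have h1 : D ≤ X.card * 2 ^ G.card := card_fiber_update G hG i u₀
    have h2 : D * S.card = ∑ x, (univ.filter fun u : Tup n => update u i x ∈ S).card := by
      have := sum_sum_update' (n := n) i fun u => if u ∈ S then 1 else 0
      simp only [sum_boole, Nat.cast_id] at this
      rw [this]; simp [D]
    have h3 : ∀ x ∈ X, N ≤
        (univ.filter fun u : Tup n => update u i x ∈ S).card * 2 ^ (G.card * T.card) := by
      intro x hx
      refine (ih (update u₀ i x)).trans ?_
      gcongr with u
      intro h
      rw [hS, mem_filter]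
      refine ⟨mem_univ _, fun g hg => ?_⟩
      rw [hpw, h g hg]
      exact (mem_filter.1 hx).2 g hg
    have h4 : X.card * N ≤ D * S.card * 2 ^ (G.card * T.card) := by
      rw [h2, sum_mul]
      calc X.card * N = ∑ x ∈ X, N := by simp
        _ ≤ ∑ x ∈ X, (univ.filter fun u : Tup n => update u i x ∈ S).card *
              2 ^ (G.card * T.card) := sum_le_sum h3
        _ ≤ _ := sum_le_sum_of_subset (subset_univ _)
    have h5 : D * N ≤ D * (S.card * 2 ^ (G.card * (insert i T).card)) := by
      calc D * N ≤ X.card * 2 ^ G.card * N := Nat.mul_le_mul_right _ h1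
        _ = X.card * N * 2 ^ G.card := by ring
        _ ≤ D * S.card * 2 ^ (G.card * T.card) * 2 ^ G.card := Nat.mul_le_mul_right _ h4
        _ = _ := by rw [card_insert_of_notMem hi]; ring
    exact Nat.le_of_mul_le_mul_left h5 hD

/-- The real form of `card_level_set`, for a family given with an upper bound on its size. -/
lemma density_level_set {L : ℕ} (G : Finset (Tup n → ZMod 2)) (hL : G.card ≤ L)
    (hG : ∀ g ∈ G, ∃ J, g ∈ multilin n J) (u₀ : Tup n) :
    (1 / 2 : ℝ) ^ (L * d) * Fintype.card (Tup n) ≤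
      (univ.filter fun u => ∀ g ∈ G, g u = g u₀).card := by
  have h : (Fintype.card (Tup n) : ℝ) ≤
      (univ.filter fun u => ∀ g ∈ G, g u = g u₀).card * 2 ^ (G.card * d) := by
    exact_mod_cast card_level_set G hG u₀
  have h' : (2 : ℝ) ^ (G.card * d) ≤ 2 ^ (L * d) :=
    pow_le_pow_right₀ one_le_two (Nat.mul_le_mul_right _ hL)
  rw [one_div, inv_pow, inv_mul_le_iff₀ (by positivity), mul_comm]
  exact h.trans (by gcongr)

/-! ### Robust intersections -/

/-- The proportion of non-zeros that is tolerated for arrays with `k` axes. -/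
noncomputable def tol (k : ℕ) : ℝ := (1 / 16) ^ (k + 1)

lemma tol_pos (k : ℕ) : 0 < tol k := by unfold tol; positivity

/-- The statement proved by induction on `#I`: the elements of `𝔽₂^I` that vanish on all but a
small proportion (depending only on `#I`) of a dense weighted set of tuples lie in a degenerate
space of bounded size. -/
def MostlyZeroDegenerate (I : Finset (Fin d)) : Prop :=
  ∀ δ : ℝ, 0 < δ → ∃ C : ℕ, ∀ (n : Fin d → ℕ) (w : Tup n → ℝ),
    (∀ u, 0 ≤ w u) → (∀ u, w u ≤ 1) → δ * Fintype.card (Tup n) ≤ ∑ u, w u →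
    ∃ G : Finset (Form n), Valid I G ∧ G.card ≤ C ∧ ∀ r ∈ multilin n I,
      ∑ u with r u ≠ 0, w u ≤ tol I.card * ∑ u, w u → r ∈ degen I G

/-- Suppose that families `G ω` of boundedly many forms are given. The `v ∈ 𝔽₂^I` that vanish on
the common zeros of `G ω` for a positive proportion of the `ω` lie in one degenerate space of
bounded size. Taking together the forms of several independent `ω` makes the proportion as close
to `1` as `MostlyZeroDegenerate` needs. -/
lemma exists_degen_of_vanishing (hI : MostlyZeroDegenerate I) (L : ℕ) {τ : ℝ} (hτ : 0 < τ) :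
    ∃ C : ℕ, ∀ (n : Fin d → ℕ) (Ω : Type) [Fintype Ω] [Nonempty Ω] (G : Ω → Finset (Form n)),
      (∀ ω, (G ω).card ≤ L) → (∀ ω, ∀ g ∈ G ω, g.1.Nonempty ∧ g.2 ∈ multilin n g.1) →
      ∃ G' : Finset (Form n), Valid I G' ∧ G'.card ≤ C ∧ ∀ v ∈ multilin n I,
        τ * Fintype.card Ω ≤
          (univ.filter fun ω => ∀ u, (∀ g ∈ G ω, g.2 u = 0) → v u = 0).card →
        v ∈ degen I G' := by
  obtain ⟨k, hk⟩ : ∃ k : ℕ, (max (1 - τ) 0) ^ k < tol I.card :=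
    exists_pow_lt_of_lt_one (tol_pos _) (max_lt (by linarith) one_pos)
  set σ : ℝ := (1 / 2 : ℝ) ^ (k * L * d) with hσ
  have hσ0 : 0 < σ := by positivity
  obtain ⟨C, hC⟩ := hI σ hσ0
  refine ⟨C, fun n Ω _ _ G hGL hG => ?_⟩
  set N : ℝ := (Fintype.card (Tup n) : ℝ) with hN
  have hN0 : 0 < N := by rw [hN]; exact_mod_cast Fintype.card_pos
  set Q : ℝ := (Fintype.card (Fin k → Ω) : ℝ) with hQ
  have hQ0 : 0 < Q := by rw [hQ]; exact_mod_cast Fintype.card_pos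
  -- the common zeros for a tuple of samples
  let S : (Fin k → Ω) → Finset (Tup n) := fun p =>
    univ.filter fun u => ∀ j, ∀ g ∈ G (p j), g.2 u = 0
  have hS : ∀ p, σ * N ≤ (S p).card := by
    intro p
    have := density_level_set (L := k * L)
      ((univ.biUnion fun j => (G (p j)).image Prod.snd)) ?_ ?_ (0 : Tup n)
    · refine this.trans ?_
      norm_cast
      refine card_le_card fun u hu => ?_
      simp only [S, mem_filter, mem_univ, true_and] at hu ⊢
      intro j g hg
      rw [hu g.2 (mem_biUnion.2 ⟨j, mem_univ _, mem_image_of_mem _ hg⟩)]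
      exact multilin_zero (hG _ g hg).2 (hG _ g hg).1
    · refine card_biUnion_le.trans ((sum_le_card_nsmul _ _ L fun j _ =>
        card_image_le.trans (hGL _)).trans ?_)
      simp
    · intro g hg
      obtain ⟨j, -, hg⟩ := mem_biUnion.1 hg
      obtain ⟨g', hg', rfl⟩ := mem_image.1 hg
      exact ⟨g'.1, (hG _ g' hg').2⟩
  have hS0 : ∀ p, (0 : ℝ) < (S p).card := fun p => (by positivity : 0 < σ * N).trans_le (hS p)
  -- choosing samples uniformly, and then a common zero uniformly, gives this density
  let w : Tup n → ℝ := fun u => Q⁻¹ * ∑ p, if u ∈ S p then σ * N / (S p).card else 0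
  have hw0 : ∀ u, 0 ≤ w u := fun u => by
    refine mul_nonneg (by positivity) (sum_nonneg fun p _ => ?_)
    split_ifs <;> positivity
  have hw1 : ∀ u, w u ≤ 1 := fun u => by
    have : ∑ p, (if u ∈ S p then σ * N / (S p).card else 0) ≤ ∑ _p : Fin k → Ω, (1 : ℝ) := by
      refine sum_le_sum fun p _ => ?_
      split_ifs
      · exact (div_le_one (hS0 p)).2 (hS p)
      · exact zero_le_one
    rw [sum_const, card_univ, nsmul_one, ← hQ] at this
    rw [inv_mul_le_iff₀ hQ0, mul_one]
    exact this
  have hwsum : ∀ (P : Tup n → Prop) [DecidablePred P], ∑ u with P u, w u =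
      Q⁻¹ * ∑ p, ((S p).filter P).card * (σ * N / (S p).card) := by
    intro P _
    simp only [w]
    rw [← mul_sum, sum_comm]
    congr 1
    refine sum_congr rfl fun p _ => ?_
    rw [← sum_filter, sum_const, nsmul_eq_mul]
    congr 3
    ext u; simp [and_comm]
  have hwtot : ∑ u, w u = σ * N := by
    have := hwsum fun _ => True
    simp only [filter_true] at this
    rw [this]
    have h : ∀ p, ((S p).card : ℝ) * (σ * N / (S p).card) = σ * N := fun p => by
      field_simp [(hS0 p).ne']
    simp only [h, sum_const, card_univ, nsmul_eq_mul, ← hQ]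
    field_simp
  obtain ⟨G', hG', hG'C, hG'r⟩ := hC n w hw0 hw1 hwtot.ge
  refine ⟨G', hG', hG'C, fun v hv hvτ => hG'r v hv ?_⟩
  rw [hwtot, hwsum fun u => v u ≠ 0]
  set Z := univ.filter fun ω => ∀ u, (∀ g ∈ G ω, g.2 u = 0) → v u = 0 with hZ
  have hbad : ∀ p : Fin k → Ω, ((S p).filter fun u => v u ≠ 0).card * (σ * N / (S p).card) ≤
      if p ∈ Fintype.piFinset (fun _ : Fin k => Zᶜ) then σ * N else 0 := by
    intro p
    split_ifs with hp
    · rw [mul_div_left_comm]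
      refine mul_le_of_le_one_right (by positivity) ((div_le_one (hS0 p)).2 ?_)
      exact_mod_cast card_filter_le _ _
    · rw [Fintype.mem_piFinset] at hp
      push Not at hp
      obtain ⟨j, hj⟩ := hp
      rw [mem_compl, not_not, hZ, mem_filter] at hj
      rw [filter_false_of_mem]
      · simp
      · intro u hu
        rw [not_not]
        exact hj.2 u ((mem_filter.1 hu).2 j)
  have hcard : (((Fintype.piFinset (fun _ : Fin k => Zᶜ)).card : ℕ) : ℝ) ≤ tol I.card * Q := by
    rw [Fintype.card_piFinset, prod_const, card_univ, Fintype.card_fin, hQ, Fintype.card_pi,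
      prod_const, card_univ, Fintype.card_fin]
    push_cast
    have hZc : ((Zᶜ.card : ℕ) : ℝ) ≤ max (1 - τ) 0 * Fintype.card Ω := by
      rw [card_compl, Nat.cast_sub (card_le_univ _)]
      have := mul_le_mul_of_nonneg_right (le_max_left (1 - τ) 0)
        (Nat.cast_nonneg (α := ℝ) (Fintype.card Ω))
      linarith
    calc ((Zᶜ.card : ℕ) : ℝ) ^ k ≤ (max (1 - τ) 0 * Fintype.card Ω) ^ k := by gcongr
      _ = (max (1 - τ) 0) ^ k * (Fintype.card Ω : ℝ) ^ k := mul_pow _ _ _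
      _ ≤ _ := by gcongr
  calc Q⁻¹ * ∑ p, ((S p).filter fun u => v u ≠ 0).card * (σ * N / (S p).card)
      ≤ Q⁻¹ * ∑ p, if p ∈ Fintype.piFinset (fun _ : Fin k => Zᶜ) then σ * N else 0 := by
        gcongr with p; exact hbad p
    _ = Q⁻¹ * ((Fintype.piFinset (fun _ : Fin k => Zᶜ)).card * (σ * N)) := by
        rw [← sum_filter, filter_mem_eq_inter, univ_inter, sum_const, nsmul_eq_mul]
    _ ≤ Q⁻¹ * (tol I.card * Q * (σ * N)) := by gcongr
    _ = tol I.card * (σ * N) := by field_simp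

/-! ### Arrays all of whose slices are degenerate -/

/-- The members of `G` with `g.1 = R` only contribute a sum of some of them, since their
cofactors are constants. -/
lemma exists_full_part {R : Finset (Fin d)} {G : Finset (Form n)} {f : Tup n → ZMod 2}
    (hf : f ∈ degen R G) :
    ∃ A ⊆ G.filter fun g => g.1 = R,
      f - ∑ g ∈ A, g.2 ∈ degen R (G.filter fun g => g.1 ≠ R) := by
  obtain ⟨h, hh, rfl⟩ := mem_degen_iff.1 hf
  refine ⟨G.filter fun g => g.1 = R ∧ h g 0 = 1, fun g hg => ?_, ?_⟩
  · simp only [mem_filter] at hg ⊢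
    exact ⟨hg.1, hg.2.1⟩
  · rw [← sum_filter_add_sum_filter_not G (fun g => g.1 = R)]
    have : ∑ g ∈ G.filter (fun g => g.1 = R), g.2 * h g =
        ∑ g ∈ G.filter (fun g => g.1 = R ∧ h g 0 = 1), g.2 := by
      rw [← filter_filter, sum_filter (fun g => h g 0 = 1)]
      refine sum_congr rfl fun g hg => ?_
      have hc : ∀ u, h g u = h g 0 := fun u =>
        multilin_congr (hh g) fun i hi => by simp [(mem_filter.1 hg).2] at hi
      have h01 : h g 0 = 0 ∨ h g 0 = 1 := by generalize h g 0 = c; revert c; decide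
      rcases h01 with h0 | h1
      · rw [if_neg (by simp [h0])]
        funext u; simp [hc u, h0]
      · rw [if_pos h1]
        funext u; simp [hc u, h1]
    rw [this, add_sub_cancel_left]
    exact Submodule.sum_mem _ fun g hg => mul_mem_degen hg (hh g)

/-- On the common zeros of a bounded family of forms that do not involve the axis `i₁`, an
element of a degenerate space agrees with a sum of members of the family that involve all
axes. In each other product `g ⊗ h`, one of the two factors does not involve `i₁`. -/
lemma exists_forms_of_mem_degen {R : Finset (Fin d)} (i₁ : Fin d)
    {G : Finset (Form n)} (hG : Valid R G) {f : Tup n → ZMod 2} (hf : f ∈ degen R G) :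
    ∃ A ⊆ G.filter fun g => g.1 = R, ∃ Q : Finset (Tup n → ZMod 2), Q.card ≤ G.card ∧
      (∀ q ∈ Q, ∃ J : Finset (Fin d), J.Nonempty ∧ i₁ ∉ J ∧ q ∈ multilin n J) ∧
      ∀ t, (∀ q ∈ Q, q t = 0) → f t = ∑ g ∈ A, g.2 t := by
  obtain ⟨A, hA, hfA⟩ := exists_full_part hf
  obtain ⟨h, hh, he⟩ := mem_degen_iff.1 hfA
  refine ⟨A, hA, (G.filter fun g => g.1 ≠ R).image fun g => if i₁ ∈ g.1 then h g else g.2,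
    card_image_le.trans (card_filter_le _ _), ?_, fun t ht => ?_⟩
  · intro q hq
    obtain ⟨g, hg, rfl⟩ := mem_image.1 hq
    obtain ⟨hg, hgR⟩ := mem_filter.1 hg
    obtain ⟨hg1, hg2, hg3⟩ := hG g hg
    by_cases hi : i₁ ∈ g.1
    · rw [if_pos hi]
      refine ⟨R \ g.1, sdiff_nonempty.2 fun hR => hgR (hg1.antisymm hR), ?_, hh g⟩
      simp [hi]
    · rw [if_neg hi]
      exact ⟨g.1, hg2, hi, hg3⟩
  · have : (f - ∑ g ∈ A, g.2) t = 0 := by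
      rw [he, Finset.sum_apply]
      refine sum_eq_zero fun g hg => ?_
      have := ht _ (mem_image_of_mem _ hg)
      by_cases hi : i₁ ∈ g.1
      · rw [if_pos hi] at this
        simp [this]
      · rw [if_neg hi] at this
        simp [this]
    rw [Pi.sub_apply, Finset.sum_apply, sub_eq_zero] at this
    exact this

/-- Expansion of a multilinear function along the axis `i`. -/
lemma multilin_expand {f : Tup n → ZMod 2} (hf : f ∈ multilin n I) {i : Fin d} (hi : i ∈ I)
    (t : Tup n) : f t = ∑ l, f (update t i (Pi.single l 1)) * t i l := by
  let φ : (Fin (n i) → ZMod 2) →ₗ[ZMod 2] ZMod 2 :=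
    AddMonoidHom.toZModLinearMap 2
      ⟨⟨fun x => f (update t i x), multilin_update_zero hf hi t⟩, multilin_update_add hf hi t⟩
  have h := LinearMap.pi_apply_eq_sum_univ φ (t i)
  have h' : φ (t i) = f t := congrArg f (update_eq_self i t)
  rw [h'] at h
  rw [h]
  refine sum_congr rfl fun l _ => ?_
  rw [smul_eq_mul, mul_comm]
  congr 1
  refine congrArg f (congrArg (update t i) (funext fun j => ?_))
  simp [Pi.single_apply, eq_comm]

lemma coord_mem_multilin (i : Fin d) (l : Fin (n i)) :
    (fun t : Tup n => t i l) ∈ multilin n {i} := by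
  refine ⟨fun u u' h => ?_, fun j hj u x y => ?_⟩
  · simp only [h i (mem_singleton_self i)]
  · rw [mem_singleton] at hj
    subst hj
    simp

/-- If all slices of `B` along the axis `i₁` lie in one degenerate space, then so does `B`. The
factors containing the axis `i₀` can be traded for their cofactors. -/
lemma exists_degen_of_slices {R : Finset (Fin d)} {i₀ i₁ : Fin d} (hi₀ : i₀ ∉ R) (hi₁ : i₁ ∈ R)
    {B : Tup n → ZMod 2} (hB : B ∈ multilin n (insert i₀ R)) {G : Finset (Form n)}
    (hG : Valid (insert i₀ (R.erase i₁)) G)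
    (h : ∀ u, restrict {i₁} u B ∈ degen (insert i₀ (R.erase i₁)) G) :
    ∃ H : Finset (Form n), Valid R H ∧ H.card ≤ G.card ∧ B ∈ degen (insert i₀ R) H := by
  have hne : i₀ ≠ i₁ := fun h => hi₀ (h ▸ hi₁)
  have hsub : insert i₀ (R.erase i₁) ⊆ insert i₀ R := insert_subset_insert _ (erase_subset _ _)
  have hBG : B ∈ degen (insert i₀ R) G := by
    have hexp : B = ∑ l, restrict {i₁} (update 0 i₁ (Pi.single l 1)) B * fun t => t i₁ l := by
      funext t
      rw [multilin_expand hB (mem_insert_of_mem hi₁) t, Finset.sum_apply]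
      refine sum_congr rfl fun l _ => ?_
      rw [Pi.mul_apply, restrict_singleton, update_self]
    rw [hexp]
    refine Submodule.sum_mem _ fun l _ => degen_mul_mem hG hsub (h _) ?_
    convert coord_mem_multilin i₁ l using 2
    ext j
    simp only [mem_sdiff, mem_insert, mem_erase, mem_singleton]
    constructor
    · tauto
    · rintro rfl
      exact ⟨Or.inr hi₁, by simp [hne.symm]⟩
  obtain ⟨b, hb, he⟩ := mem_degen_iff.1 hBG
  refine ⟨G.image fun g => if i₀ ∈ g.1 then (insert i₀ R \ g.1, b g) else g, ?_, card_image_le, ?_⟩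
  · intro g' hg'
    obtain ⟨g, hg, rfl⟩ := mem_image.1 hg'
    obtain ⟨hg1, hg2, hg3⟩ := hG g hg
    split_ifs with hi
    · refine ⟨fun j hj => ?_, ⟨i₁, ?_⟩, hb g⟩
      · simp only [mem_sdiff, mem_insert] at hj
        rcases hj.1 with rfl | h'
        · exact absurd hi hj.2
        · exact h'
      · simp only [mem_sdiff, mem_insert, hi₁, or_true, true_and]
        intro h'
        have := hg1 h'
        simp [hne.symm] at this
    · refine ⟨fun j hj => ?_, hg2, hg3⟩
      have := hg1 hj
      simp only [mem_insert, mem_erase] at this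
      rcases this with rfl | h'
      · exact absurd hj hi
      · exact h'.2
  · rw [he]
    refine Submodule.sum_mem _ fun g hg => ?_
    have hmem := mem_image_of_mem
      (fun g : Form n => if i₀ ∈ g.1 then (insert i₀ R \ g.1, b g) else g) hg
    by_cases hi : i₀ ∈ g.1
    · rw [if_pos hi] at hmem
      have hg2 : g.2 ∈ multilin n (insert i₀ R \ (insert i₀ R \ g.1)) := by
        rw [Finset.sdiff_sdiff_eq_self ((hG g hg).1.trans hsub)]
        exact (hG g hg).2.2
      have := mul_mem_degen hmem hg2
      rwa [mul_comm] at this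
    · rw [if_neg hi] at hmem
      exact mul_mem_degen hmem (hb g)

/-- Let `B` have the axes `i₀` and `R ∋ i₁`. If for many `u` the slice of `B` at `u i₀` lies in the
degenerate space of boundedly many forms, where the forms that involve all of `R` do not depend
on `u i₀`, then `B` lies in a degenerate space for boundedly many forms on `R`. Cancelling the
latter forms by subtracting two slices, one finds that `B` vanishes identically in the axis `i₁`
for many values of the other axes. -/
lemma exists_degen_of_dense_slices {R : Finset (Fin d)} {i₀ i₁ : Fin d} (hi₀ : i₀ ∉ R)
    (hi₁ : i₁ ∈ R) (hA : MostlyZeroDegenerate (insert i₀ (R.erase i₁))) (L : ℕ) {κ : ℝ}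
    (hκ : 0 < κ) :
    ∃ C : ℕ, ∀ (n : Fin d → ℕ) (B : Tup n → ZMod 2) (G H : Tup n → Finset (Form n)),
      B ∈ multilin n (insert i₀ R) →
      (∀ u, Valid R (G u)) → (∀ u, ∀ g ∈ G u, g.1 ≠ R) → (∀ u, (G u).card ≤ L) →
      (∀ u, Valid R (H u)) → (∀ u, (H u).card ≤ L) → (∀ u x, H (update u i₀ x) = H u) →
      κ * Fintype.card (Tup n) ≤
        (univ.filter fun u => restrict {i₀} u B ∈ degen R (G u ∪ H u)).card →
      ∃ H' : Finset (Form n), Valid R H' ∧ H'.card ≤ C ∧ B ∈ degen (insert i₀ R) H' := by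
  have hne : i₀ ≠ i₁ := fun h => hi₀ (h ▸ hi₁)
  set σ : ℝ := (1 / 2 : ℝ) ^ (2 * L * d) with hσ
  have hσ0 : 0 < σ := by positivity
  set δ : ℝ := κ * σ / 2 ^ L with hδ
  have hδ0 : 0 < δ := by positivity
  obtain ⟨C, hC⟩ := hA δ hδ0
  refine ⟨C, fun n B G H hB hG hGR hGL hH hHL hHi hdense => ?_⟩
  set N : ℝ := (Fintype.card (Tup n) : ℝ) with hN
  have hN0 : 0 < N := by rw [hN]; exact_mod_cast Fintype.card_pos
  set D : ℝ := (Fintype.card (Fin (n i₀) → ZMod 2) : ℝ) with hD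
  have hD0 : 0 < D := by rw [hD]; exact_mod_cast Fintype.card_pos
  set Ω := univ.filter fun u => restrict {i₀} u B ∈ degen R (G u ∪ H u) with hΩ
  -- `Z A y` is where the slice at `y` agrees with the sum of `A`, for all values at `i₁`
  let Z : Finset (Form n) → (Fin (n i₀) → ZMod 2) → Finset (Tup n) := fun A y =>
    univ.filter fun t => ∀ x, B (update (update t i₁ x) i₀ y) = ∑ g ∈ A, g.2 (update t i₁ x)
  have hZ : ∀ u ∈ Ω, ∃ A ⊆ (H u).filter fun g => g.1 = R, σ * N ≤ (Z A (u i₀)).card := by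
    intro u hu
    obtain ⟨A, hA, Q, hQ, hQJ, hQt⟩ := exists_forms_of_mem_degen i₁ ((hG u).union (hH u))
      (mem_filter.1 hu).2
    refine ⟨A, fun g hg => ?_, ?_⟩
    · obtain ⟨hg, hgR⟩ := mem_filter.1 (hA hg)
      refine mem_filter.2 ⟨(mem_union.1 hg).resolve_left fun h => hGR u g h hgR, hgR⟩
    · refine (density_level_set (L := 2 * L) Q ?_ ?_ (0 : Tup n)).trans ?_
      · refine hQ.trans ((card_union_le _ _).trans ?_)
        have := hGL u; have := hHL u; omega
      · intro q hq
        obtain ⟨J, -, -, hJ⟩ := hQJ q hq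
        exact ⟨J, hJ⟩
      · norm_cast
        refine card_le_card fun t ht => ?_
        simp only [mem_filter, mem_univ, true_and, Z] at ht ⊢
        intro x
        rw [← restrict_singleton i₀ u B]
        refine hQt _ fun q hq => ?_
        obtain ⟨J, hJ, hJi, hqJ⟩ := hQJ q hq
        rw [multilin_update_of_notMem hqJ hJi, ht q hq, multilin_zero hqJ hJ]
  choose! A hAH hAZ using hZ
  -- a point `u` such that many of the points differing from it only in the axis `i₀` are in `Ω`
  obtain ⟨u, hu⟩ : ∃ u, κ * D ≤ (univ.filter fun x => update u i₀ x ∈ Ω).card := by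
    by_contra! hcon
    have h1 := sum_sum_update' (n := n) i₀ fun u => if u ∈ Ω then (1 : ℝ) else 0
    rw [sum_comm] at h1
    simp only [sum_boole, filter_mem_eq_inter, univ_inter, nsmul_eq_mul] at h1
    have h2 : ∑ u : Tup n, ((univ.filter fun x => update u i₀ x ∈ Ω).card : ℝ) <
        ∑ _u : Tup n, κ * D := sum_lt_sum_of_nonempty univ_nonempty fun u _ => hcon u
    rw [h1, sum_const, card_univ, nsmul_eq_mul, ← hN] at h2
    nlinarith [mul_le_mul_of_nonneg_left hdense hD0.le]
  set Y := univ.filter fun x => update u i₀ x ∈ Ω with hY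
  -- the same set `A` occurs for many of these points
  obtain ⟨A₀, hA₀H, hA₀⟩ : ∃ A₀ ∈ ((H u).filter fun g => g.1 = R).powerset,
      κ * D / 2 ^ L ≤ (Y.filter fun x => A (update u i₀ x) = A₀).card := by
    by_contra! hcon
    have hmaps : ∀ x ∈ Y, A (update u i₀ x) ∈ ((H u).filter fun g => g.1 = R).powerset := by
      intro x hx
      have := hAH _ (mem_filter.1 hx).2
      rwa [hHi, ← mem_powerset] at this
    have h1 := card_eq_sum_card_fiberwise hmaps
    have h2 : (Y.card : ℝ) < ∑ _A₀ ∈ ((H u).filter fun g => g.1 = R).powerset, κ * D / 2 ^ L := by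
      rw [h1]; push_cast
      exact sum_lt_sum_of_nonempty (powerset_nonempty _) hcon
    rw [sum_const, card_powerset, nsmul_eq_mul] at h2
    have h3 : (((2 ^ ((H u).filter fun g => g.1 = R).card : ℕ)) : ℝ) ≤ 2 ^ L := by
      push_cast
      exact pow_le_pow_right₀ one_le_two ((card_filter_le _ _).trans (hHL u))
    have h4 := mul_le_mul_of_nonneg_right h3 (by positivity : 0 ≤ κ * D / 2 ^ L)
    rw [mul_div_cancel₀ _ (by positivity)] at h4
    linarith
  set Y₀ := Y.filter fun x => A (update u i₀ x) = A₀ with hY₀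
  have hY₀Z : ∀ y ∈ Y₀, σ * N ≤ (Z A₀ y).card := by
    intro y hy
    obtain ⟨hy, hyA⟩ := mem_filter.1 hy
    have := hAZ _ (mem_filter.1 hy).2
    rwa [hyA, update_self] at this
  have hA₀i : ∀ (t : Tup n) y, ∑ g ∈ A₀, g.2 (update t i₀ y) = ∑ g ∈ A₀, g.2 t := fun t y =>
    sum_congr rfl fun g hg => by
      have hg' := (mem_filter.1 (mem_powerset.1 hA₀H hg)).1
      exact multilin_update_of_notMem (hH u g hg').2.2 (fun h => hi₀ ((hH u g hg').1 h)) _ _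
  -- subtracting two slices
  let V : Finset (Tup n) := univ.filter fun t => ∀ x, B (update t i₁ x) = 0
  have hslice : ∀ t : Tup n, (Y₀.filter fun y => t ∈ Z A₀ y).card ≤
      (univ.filter fun y => update t i₀ y ∈ V).card := by
    intro t
    rcases (Y₀.filter fun y => t ∈ Z A₀ y).eq_empty_or_nonempty with h | ⟨y₀, hy₀⟩
    · rw [h]; simp
    refine card_le_card_of_injOn (fun y => y + y₀) (fun y hy => ?_)
      fun x _ y _ h => by simpa using h
    have h1 := (mem_filter.1 (mem_filter.1 hy₀).2).2
    have h2 := (mem_filter.1 (mem_filter.1 hy).2).2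
    simp only [coe_filter, mem_univ, true_and, Set.mem_ofPred_eq, V, mem_filter]
    intro x
    rw [update_comm hne, multilin_update_add hB (mem_insert_self _ _), h1, h2,
      CharTwo.add_self_eq_zero]
  have hV : δ * N ≤ V.card := by
    have h1 : ∑ t : Tup n, ((Y₀.filter fun y => t ∈ Z A₀ y).card : ℝ) =
        ∑ y ∈ Y₀, ((Z A₀ y).card : ℝ) := by
      have := sum_card_bipartiteAbove_eq_sum_card_bipartiteBelow (s := (univ : Finset (Tup n)))
        (t := Y₀) (fun t y => t ∈ Z A₀ y)
      simp only [bipartiteAbove, bipartiteBelow, filter_mem_eq_inter, univ_inter] at this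
      exact_mod_cast this
    have h2 : (Y₀.card : ℝ) * (σ * N) ≤ ∑ y ∈ Y₀, ((Z A₀ y).card : ℝ) := by
      rw [← nsmul_eq_mul]; exact card_nsmul_le_sum _ _ _ hY₀Z
    have h3 : ∑ t : Tup n, ((univ.filter fun y => update t i₀ y ∈ V).card : ℝ) = D * V.card := by
      have h1 := sum_sum_update' (n := n) i₀ fun u => if u ∈ V then (1 : ℝ) else 0
      rw [sum_comm] at h1
      simpa only [sum_boole, filter_mem_eq_inter, univ_inter, nsmul_eq_mul] using h1
    have h4 : ∑ t : Tup n, ((Y₀.filter fun y => t ∈ Z A₀ y).card : ℝ) ≤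
        ∑ t : Tup n, ((univ.filter fun y => update t i₀ y ∈ V).card : ℝ) :=
      sum_le_sum fun t _ => by exact_mod_cast hslice t
    have h5 : κ * D / 2 ^ L * (σ * N) ≤ Y₀.card * (σ * N) := by gcongr
    have h6 : D * (δ * N) = κ * D / 2 ^ L * (σ * N) := by rw [hδ]; ring
    have h7 : D * (δ * N) ≤ D * V.card := by linarith
    exact le_of_mul_le_mul_left h7 hD0
  obtain ⟨G', hG', hG'C, hG'r⟩ := hC n (fun t => if t ∈ V then 1 else 0)
    (fun t => by split_ifs <;> simp) (fun t => by split_ifs <;> simp)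
    (by simpa only [sum_boole, filter_mem_eq_inter, univ_inter] using hV)
  obtain ⟨H', h1, h2, h3⟩ := exists_degen_of_slices hi₀ hi₁ hB hG' fun v => by
    refine hG'r _ ?_ ?_
    · convert restrict_mem hB {i₁} v using 2
      ext j
      simp only [mem_insert, mem_erase, mem_sdiff, mem_singleton]
      constructor
      · rintro (rfl | h)
        · exact ⟨Or.inl rfl, hne⟩
        · tauto
      · tauto
    · rw [sum_eq_zero]
      · have := tol_pos (insert i₀ (R.erase i₁)).card
        simp only [sum_boole]
        positivity
      · intro t ht
        rw [if_neg]
        intro htV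
        refine (mem_filter.1 ht).2 ?_
        rw [restrict_singleton]
        exact (mem_filter.1 htV).2 _
  exact ⟨H', h1, h2.trans hG'C, h3⟩

/-! ### Approximation by finitely many arrays -/

/-- A finite set `ℬ` whose subsets of size `m` always contain two related elements is covered by
fewer than `m` of its elements. -/
lemma exists_small_net {α : Type*} (ℬ : Finset α) (near : α → α → Prop) (hrefl : ∀ a, near a a)
    (hsymm : ∀ a b, near a b → near b a) (m : ℕ)
    (h : ∀ W ⊆ ℬ, W.card = m → ∃ a ∈ W, ∃ b ∈ W, a ≠ b ∧ near a b) :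
    ∃ W ⊆ ℬ, W.card ≤ m ∧ ∀ a ∈ ℬ, ∃ w ∈ W, near a w := by
  obtain ⟨W, hW, hmax⟩ := exists_max_image
    (ℬ.powerset.filter fun W => ∀ a ∈ W, ∀ b ∈ W, near a b → a = b) card ⟨∅, by simp⟩
  simp only [mem_filter, mem_powerset] at hW hmax
  refine ⟨W, hW.1, ?_, fun a ha => ?_⟩
  · by_contra! hlt
    obtain ⟨W', hW', hcard⟩ := exists_subset_card_eq hlt.le
    obtain ⟨a, ha, b, hb, hab, hn⟩ := h W' (hW'.trans hW.1) hcard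
    exact hab (hW.2 a (hW' ha) b (hW' hb) hn)
  · by_contra! hcon
    have haW : a ∉ W := fun h => hcon a h (hrefl a)
    have := hmax (insert a W) ⟨insert_subset ha hW.1, ?_⟩
    · rw [card_insert_of_notMem haW] at this
      omega
    · intro x hx y hy hxy
      rcases mem_insert.1 hx with rfl | hx' <;> rcases mem_insert.1 hy with rfl | hy'
      · rfl
      · exact absurd hxy (hcon y hy')
      · exact absurd (hsymm _ _ hxy) (hcon x hx')
      · exact hW.2 x hx' y hy' hxy

lemma sub_mem_degen_union {P H H' : Finset (Form n)} {f f' a : Tup n → ZMod 2}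
    (h : f - a ∈ degen I (P ∪ H)) (h' : f' - a ∈ degen I (P ∪ H')) :
    f - f' ∈ degen I (P ∪ (H ∪ H')) := by
  have hs : P ∪ H ⊆ P ∪ (H ∪ H') := union_subset_union_right subset_union_left
  have hs' : P ∪ H' ⊆ P ∪ (H ∪ H') := union_subset_union_right subset_union_right
  have := Submodule.sub_mem _ (degen_mono hs h) (degen_mono hs' h')
  rwa [sub_sub_sub_cancel_right] at this

/-- Let `B` have the axes `i₀` and `R`, and suppose that for many `u` the slice of `B` at `u i₀`
lies in the degenerate space given by forms `G u`, which are independent of `B`, and forms `H u`,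
which may depend on `B` but not on `u i₀`. Then up to an error which is degenerate with forms on
`R`, there are boundedly many such `B`. Indeed, among many `B` there are two for which the members
of `G u` involving all of `R` enter in the same way, and `exists_degen_of_dense_slices` applies to
their difference. -/
lemma exists_net_of_dense_slices {R : Finset (Fin d)} {i₀ i₁ : Fin d} (hi₀ : i₀ ∉ R)
    (hi₁ : i₁ ∈ R) (hA : MostlyZeroDegenerate (insert i₀ (R.erase i₁))) (L : ℕ) {κ : ℝ}
    (hκ : 0 < κ) :
    ∃ m C : ℕ, ∀ (n : Fin d → ℕ) (G : Tup n → Finset (Form n)),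
      (∀ u, Valid R (G u)) → (∀ u, (G u).card ≤ L) →
      ∃ W : Finset (Tup n → ZMod 2), W.card ≤ m ∧ (∀ w ∈ W, w ∈ multilin n (insert i₀ R)) ∧
        ∀ (B : Tup n → ZMod 2) (H : Tup n → Finset (Form n)), B ∈ multilin n (insert i₀ R) →
          (∀ u, Valid R (H u)) → (∀ u, (H u).card ≤ L) → (∀ u x, H (update u i₀ x) = H u) →
          κ * Fintype.card (Tup n) ≤
            (univ.filter fun u => restrict {i₀} u B ∈ degen R (G u ∪ H u)).card →
          ∃ w ∈ W, ∃ H' : Finset (Form n), Valid R H' ∧ H'.card ≤ C ∧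
            B - w ∈ degen (insert i₀ R) H' := by
  obtain ⟨m, hm⟩ := exists_nat_ge (2 ^ (L + 1) / κ)
  have hm0 : (0 : ℝ) < m := (by positivity : 0 < 2 ^ (L + 1) / κ).trans_le hm
  have hm2 : 2 * 2 ^ L ≤ κ * m := by
    rw [div_le_iff₀ hκ] at hm
    rw [mul_comm κ]
    exact (by ring : (2 : ℝ) * 2 ^ L = 2 ^ (L + 1)).trans_le hm
  obtain ⟨C, hC⟩ := exists_degen_of_dense_slices hi₀ hi₁ hA (2 * L)
    (κ := κ / 2 / (m * m)) (by positivity)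
  refine ⟨m, C, fun n G hG hGL => ?_⟩
  set N : ℝ := (Fintype.card (Tup n) : ℝ) with hN
  let P : (Tup n → ZMod 2) → (Tup n → Finset (Form n)) → Prop := fun B H =>
    B ∈ multilin n (insert i₀ R) ∧
      (∀ u, Valid R (H u)) ∧ (∀ u, (H u).card ≤ L) ∧ (∀ u x, H (update u i₀ x) = H u) ∧
      κ * N ≤ (univ.filter fun u => restrict {i₀} u B ∈ degen R (G u ∪ H u)).card
  let ℬ : Finset (Tup n → ZMod 2) := univ.filter fun B => ∃ H, P B H
  let near : (Tup n → ZMod 2) → (Tup n → ZMod 2) → Prop := fun B B' => ∃ H' : Finset (Form n),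
    Valid R H' ∧ H'.card ≤ C ∧ B - B' ∈ degen (insert i₀ R) H'
  have hnear : ∀ W ⊆ ℬ, W.card = m → ∃ B ∈ W, ∃ B' ∈ W, B ≠ B' ∧ near B B' := by
    intro W hWℬ hWm
    have hPW : ∀ B ∈ W, ∃ H, P B H := fun B hB => (mem_filter.1 (hWℬ hB)).2
    choose! H hH using hPW
    let Ω : (Tup n → ZMod 2) → Finset (Tup n) := fun B =>
      univ.filter fun u => restrict {i₀} u B ∈ degen R (G u ∪ H B u)
    -- the part of the slice that comes from the members of `G u` involving all axes of `R`
    have hsplit : ∀ B, ∀ u ∈ Ω B, ∃ A ∈ (G u).powerset, restrict {i₀} u B - ∑ g ∈ A, g.2 ∈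
        degen R ((G u).filter (fun g => g.1 ≠ R) ∪ H B u) := by
      intro B u hu
      have h := (mem_filter.1 hu).2
      rw [degen_union] at h
      obtain ⟨f, hf, f', hf', he⟩ := Submodule.mem_sup.1 h
      obtain ⟨A, hA, hAf⟩ := exists_full_part hf
      refine ⟨A, mem_powerset.2 (hA.trans (filter_subset _ _)), ?_⟩
      rw [← he, add_sub_right_comm, degen_union]
      exact Submodule.add_mem_sup hAf hf'
    choose! A hAG hA' using hsplit
    let many := univ.filter fun u => 2 ^ L < (W.filter fun B => u ∈ Ω B).card
    have hmany : κ / 2 * N ≤ many.card := by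
      have h1 : ∑ u : Tup n, ((W.filter fun B => u ∈ Ω B).card : ℝ) =
          ∑ B ∈ W, ((Ω B).card : ℝ) := by
        have := sum_card_bipartiteAbove_eq_sum_card_bipartiteBelow (s := (univ : Finset (Tup n)))
          (t := W) (fun t B => t ∈ Ω B)
        simp only [bipartiteAbove, bipartiteBelow, filter_mem_eq_inter, univ_inter] at this
        exact_mod_cast this
      have h2 : m * (κ * N) ≤ ∑ B ∈ W, ((Ω B).card : ℝ) := by
        rw [← hWm, ← nsmul_eq_mul]
        exact card_nsmul_le_sum _ _ _ fun B hB => (hH B hB).2.2.2.2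
      have h3 : ∀ u, ((W.filter fun B => u ∈ Ω B).card : ℝ) ≤
          2 ^ L + m * if u ∈ many then 1 else 0 := by
        intro u
        split_ifs with hu
        · have : ((W.filter fun B => u ∈ Ω B).card : ℝ) ≤ m := by
            rw [← hWm]; exact_mod_cast card_filter_le _ _
          have : (0 : ℝ) ≤ 2 ^ L := by positivity
          linarith
        · have : (W.filter fun B => u ∈ Ω B).card ≤ 2 ^ L := by
            simpa [many] using hu
          rw [mul_zero, add_zero]
          exact_mod_cast this
      have h4 := sum_le_sum fun u (_ : u ∈ (univ : Finset (Tup n))) => h3 u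
      rw [h1, sum_add_distrib, sum_const, card_univ, nsmul_eq_mul, ← mul_sum, sum_boole,
        filter_mem_eq_inter, univ_inter, ← hN] at h4
      have hN0 : 0 ≤ N := by rw [hN]; positivity
      have h5 := mul_le_mul_of_nonneg_left hm2 hN0
      refine le_of_mul_le_mul_left ?_ hm0
      nlinarith
    -- two elements of `W` with the same such part
    let close : (Tup n → ZMod 2) × (Tup n → ZMod 2) → Finset (Tup n) := fun p =>
      univ.filter fun u => restrict {i₀} u (p.1 - p.2) ∈
        degen R ((G u).filter (fun g => g.1 ≠ R) ∪ (H p.1 u ∪ H p.2 u))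
    have hpair : ∀ u ∈ many, ∃ p ∈ W.offDiag, u ∈ close p := by
      intro u hu
      obtain ⟨B, hB, B', hB', hne, he⟩ := exists_ne_map_eq_of_card_lt_of_maps_to
        (s := W.filter fun B => u ∈ Ω B) (t := (G u).powerset) (f := fun B => A B u) (by
          rw [card_powerset]
          exact (Nat.pow_le_pow_right two_pos (hGL u)).trans_lt (mem_filter.1 hu).2)
        (fun B hB => hAG B u (mem_filter.1 hB).2)
      refine ⟨(B, B'), mem_offDiag.2 ⟨(mem_filter.1 hB).1, (mem_filter.1 hB').1, hne⟩,
        mem_filter.2 ⟨mem_univ _, ?_⟩⟩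
      have h1 := hA' B u (mem_filter.1 hB).2
      have h2 := hA' B' u (mem_filter.1 hB').2
      rw [he] at h1
      have h3 := sub_mem_degen_union h1 h2
      rwa [← map_sub] at h3
    obtain ⟨p, hp, hpN⟩ : ∃ p ∈ W.offDiag, κ / 2 / (m * m) * N ≤ (close p).card := by
      by_contra! hcon
      have hN0 : 0 < N := by rw [hN]; exact_mod_cast Fintype.card_pos
      have h0 : 0 < many.card := by
        exact_mod_cast (by positivity : 0 < κ / 2 * N).trans_le hmany
      obtain ⟨u, hu⟩ := card_pos.1 h0
      obtain ⟨p, hp, -⟩ := hpair u hu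
      have h1 : many ⊆ W.offDiag.biUnion close := fun u hu => mem_biUnion.2 (hpair u hu)
      have h2 : (many.card : ℝ) ≤ ∑ p ∈ W.offDiag, ((close p).card : ℝ) := by
        exact_mod_cast (card_le_card h1).trans card_biUnion_le
      have h3 := sum_lt_sum_of_nonempty ⟨p, hp⟩ hcon
      rw [sum_const, nsmul_eq_mul] at h3
      have h4 : ((W.offDiag.card : ℕ) : ℝ) ≤ m * m := by
        rw [offDiag_card, hWm]; exact_mod_cast Nat.sub_le _ _
      have h5 : (W.offDiag.card : ℝ) * (κ / 2 / (m * m) * N) ≤ m * m * (κ / 2 / (m * m) * N) := by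
        gcongr
      have h6 : m * m * (κ / 2 / (m * m) * N) = κ / 2 * N := by field_simp
      linarith
    obtain ⟨hp1, hp2, hpne⟩ := mem_offDiag.1 hp
    have hH1 := hH _ hp1
    have hH2 := hH _ hp2
    refine ⟨p.1, hp1, p.2, hp2, hpne, hC n (p.1 - p.2) (fun u => (G u).filter fun g => g.1 ≠ R)
      (fun u => H p.1 u ∪ H p.2 u) (Submodule.sub_mem _ hH1.1 hH2.1)
      (fun u g hg => hG u g (mem_filter.1 hg).1) (fun u g hg => (mem_filter.1 hg).2)
      (fun u => (card_filter_le _ _).trans ((hGL u).trans (by omega)))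
      (fun u => (hH1.2.1 u).union (hH2.2.1 u)) (fun u => (card_union_le _ _).trans ?_)
      (fun u x => ?_) hpN⟩
    · have := hH1.2.2.1 u; have := hH2.2.2.1 u; omega
    · simp only [hH1.2.2.2.1 u x, hH2.2.2.2.1 u x]
  obtain ⟨W, hWℬ, hWm, hW⟩ := exists_small_net ℬ near
    (fun B => ⟨∅, by simp [Valid], by simp, by simp⟩)
    (fun B B' ⟨H, h1, h2, h3⟩ => ⟨H, h1, h2, by rw [← neg_sub]; exact Submodule.neg_mem _ h3⟩)
    m hnear
  refine ⟨W, hWm, fun w hw => ?_, fun B H h1 h2 h3 h4 h5 =>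
    hW B (mem_filter.2 ⟨mem_univ _, H, h1, h2, h3, h4, h5⟩)⟩
  obtain ⟨H, hH⟩ := (mem_filter.1 (hWℬ hw)).2
  exact hH.1

/-! ### Projections and linear forms -/

/-- A projection onto a subspace `p` of `𝔽₂^ι`, written in coordinates; `P j` is the image of the
`j`-th basis vector. -/
lemma exists_projection {ι : Type*} [Fintype ι] [DecidableEq ι]
    (p : Submodule (ZMod 2) (ι → ZMod 2)) :
    ∃ P : ι → ι → ZMod 2, (∀ j, P j ∈ p) ∧
      (∀ c ∈ p, ∀ i, ∑ j, ((Pi.single i 1 : ι → ZMod 2) j - P j i) * c j = 0) ∧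
      ∀ f g : ι → Tup n → ZMod 2, ∑ j, f j * g j =
        ∑ j, f j * ∑ i, P j i • g i +
          ∑ i, (∑ j, ((Pi.single i 1 : ι → ZMod 2) j - P j i) • f j) * g i := by
  obtain ⟨π, hπ⟩ := LinearMap.exists_leftInverse_of_injective p.subtype (Submodule.ker_subtype p)
  refine ⟨fun j => (π (Pi.single j 1) : ι → ZMod 2), fun j => (π _).2, fun c hc i => ?_,
    fun f g => ?_⟩
  · have h1 : (π c : ι → ZMod 2) = c := congrArg Subtype.val (LinearMap.congr_fun hπ ⟨c, hc⟩)
    have h2 : c = ∑ j, c j • (Pi.single j 1 : ι → ZMod 2) := by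
      funext k; simp [Finset.sum_apply, Pi.single_apply]
    have h3 : c i = ∑ j, c j * (π (Pi.single j 1) : ι → ZMod 2) i := by
      have h4 := congrFun h1 i
      rw [h2] at h4
      simp only [map_sum, map_smul, Submodule.coe_sum, Submodule.coe_smul, Finset.sum_apply,
        Pi.smul_apply, smul_eq_mul] at h4
      rw [h4]
      simp [Pi.single_apply]
    simp only [sub_mul, sum_sub_distrib]
    rw [sub_eq_zero]
    have h5 : ∑ j, (Pi.single i 1 : ι → ZMod 2) j * c j = c i := by simp [Pi.single_apply]
    rw [h5, h3]
    exact sum_congr rfl fun j _ => mul_comm _ _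
  · simp only [mul_sum, sum_mul, sub_smul, sub_mul, sum_sub_distrib, smul_mul_assoc,
      mul_smul_comm]
    rw [sum_comm (f := fun i j => (π (Pi.single j 1) : ι → ZMod 2) i • (f j * g i))]
    simp [Pi.single_apply, ite_smul]

/-- Only boundedly many linear forms on `𝔽₂^{n i}` vanish on three quarters of a dense weighted
set, by the orthogonality of characters. -/
lemma card_mostlyZero_linear {i : Fin d} {δ : ℝ} (hδ : 0 < δ)
    (W : (Fin (n i) → ZMod 2) → ℝ) (hW0 : ∀ y, 0 ≤ W y) (hW1 : ∀ y, W y ≤ 1)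
    (hW : δ * Fintype.card (Fin (n i) → ZMod 2) ≤ ∑ y, W y)
    (V : Finset (Tup n → ZMod 2)) (hV : ∀ b ∈ V, b ∈ multilin n {i} ∧
      ∑ y with b (update 0 i y) ≠ 0, W y ≤ 1 / 4 * ∑ y, W y) :
    (V.card : ℝ) ≤ 4 / δ := by
  set D : ℝ := (Fintype.card (Fin (n i) → ZMod 2) : ℝ) with hD
  have hD0 : 0 < D := by rw [hD]; exact_mod_cast Fintype.card_pos
  set s := ∑ y, W y with hs
  have hs0 : 0 < s := (mul_pos hδ hD0).trans_le hW
  let χ : (Tup n → ZMod 2) → (Fin (n i) → ZMod 2) → ℝ := fun b y =>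
    if b (update 0 i y) = 0 then 1 else -1
  have hχ1 : ∀ b ∈ V, s / 2 ≤ ∑ y, W y * χ b y := by
    intro b hb
    have h1 : ∑ y, W y * χ b y = s - 2 * ∑ y with b (update 0 i y) ≠ 0, W y := by
      rw [sum_filter, mul_sum, hs, ← sum_sub_distrib]
      refine sum_congr rfl fun y _ => ?_
      by_cases h : b (update 0 i y) = 0 <;> simp [χ, h]
      ring
    have := (hV b hb).2
    linarith
  have horth : ∀ b ∈ V, ∀ b' ∈ V, b ≠ b' → ∑ y, χ b y * χ b' y = 0 := by
    intro b hb b' hb' hne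
    obtain ⟨u, hu⟩ := Function.ne_iff.1 hne
    set z := u i
    have hz : b (update 0 i z) ≠ b' (update 0 i z) := by
      have h : ∀ f ∈ multilin n {i}, f (update 0 i z) = f u := fun f hf =>
        multilin_congr hf fun j hj => by rw [mem_singleton] at hj; subst hj; simp [z]
      rwa [h b (hV b hb).1, h b' (hV b' hb').1]
    have hsign : ∀ p q p' q' : ZMod 2, p ≠ q →
        (if p' + p = 0 then (1 : ℤ) else -1) * (if q' + q = 0 then 1 else -1) =
          -((if p' = 0 then 1 else -1) * (if q' = 0 then 1 else -1)) := by decide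
    -- translation by `z` changes the sign of the sum
    have hshift : ∀ y, χ b (y + z) * χ b' (y + z) = -(χ b y * χ b' y) := by
      intro y
      simp only [χ]
      rw [multilin_update_add (hV b hb).1 (mem_singleton_self i),
        multilin_update_add (hV b' hb').1 (mem_singleton_self i)]
      exact_mod_cast hsign _ _ _ _ hz
    have h1 := Fintype.sum_equiv (Equiv.addRight z) (fun y => χ b (y + z) * χ b' (y + z))
      (fun y => χ b y * χ b' y) fun y => rfl
    simp only [hshift, sum_neg_distrib] at h1
    linarith
  have hsq : ∑ y, (∑ b ∈ V, χ b y) ^ 2 = D * V.card := by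
    simp only [sq, sum_mul_sum]
    rw [sum_comm]
    have : ∀ b ∈ V, ∑ y, ∑ b' ∈ V, χ b y * χ b' y = D := by
      intro b hb
      rw [sum_comm, sum_eq_single_of_mem b hb fun b' hb' hne => horth b hb b' hb' hne.symm]
      have : ∀ y, χ b y * χ b y = 1 := fun y => by simp only [χ]; split_ifs <;> norm_num
      simp [this, hD]
    rw [sum_congr rfl this, sum_const, nsmul_eq_mul, mul_comm]
  have hcs := sum_mul_sq_le_sq_mul_sq univ W fun y => ∑ b ∈ V, χ b y
  have hlow : V.card * (s / 2) ≤ ∑ y, W y * ∑ b ∈ V, χ b y := by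
    simp only [mul_sum]
    rw [sum_comm, ← nsmul_eq_mul]
    exact card_nsmul_le_sum _ _ _ hχ1
  have hW2 : ∑ y, W y ^ 2 ≤ s := sum_le_sum fun y _ => by
    nlinarith [hW0 y, hW1 y]
  have h1 : (V.card * (s / 2)) ^ 2 ≤ s * (D * V.card) := by
    calc (V.card * (s / 2)) ^ 2 ≤ (∑ y, W y * ∑ b ∈ V, χ b y) ^ 2 := by gcongr
      _ ≤ _ := hcs
      _ ≤ s * (D * V.card) := by rw [hsq]; gcongr
  rcases Nat.eq_zero_or_pos V.card with h0 | hpos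
  · rw [h0, Nat.cast_zero]; positivity
  have hpos' : (0 : ℝ) < V.card := by exact_mod_cast hpos
  rw [le_div_iff₀ hδ]
  have h2 : (V.card : ℝ) * s ≤ 4 * D := by
    have : (V.card * s) * (V.card * s) ≤ (4 * D) * (V.card * s) := by nlinarith
    exact le_of_mul_le_mul_right this (by positivity)
  have h3 : (V.card : ℝ) * (δ * D) ≤ V.card * s := by gcongr
  have h4 : (V.card * δ) * D ≤ 4 * D := by linarith
  exact le_of_mul_le_mul_right h4 hD0

/-! ### Treating one set of axes -/

/-- The slice of `f` at the value `y` of the axis `i`. -/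
noncomputable abbrev slice (i : Fin d) (y : Fin (n i) → ZMod 2) :
    (Tup n → ZMod 2) →ₗ[ZMod 2] (Tup n → ZMod 2) := restrict {i} (update 0 i y)

lemma slice_apply (i : Fin d) (y : Fin (n i) → ZMod 2) (f : Tup n → ZMod 2) (t : Tup n) :
    slice i y f t = f (update t i y) := by
  rw [restrict_singleton, update_self]

lemma restrict_singleton_eq_slice (i : Fin d) (u : Tup n) (f : Tup n → ZMod 2) :
    restrict {i} u f = slice i (u i) f :=
  restrict_congr (by simp) f

lemma restrict_mem_degen_of_disjoint {G : Finset (Form n)}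
    (hG : ∀ g ∈ G, Disjoint g.1 A ∧ g.2 ∈ multilin n g.1) (u : Tup n) {f : Tup n → ZMod 2}
    (hf : f ∈ degen I G) : restrict A u f ∈ degen (I \ A) G := by
  obtain ⟨h, hh, rfl⟩ := mem_degen_iff.1 hf
  rw [map_sum]
  refine Submodule.sum_mem _ fun g hg => ?_
  rw [restrict_mul, restrict_of_disjoint (hG g hg).2 (hG g hg).1]
  refine mul_mem_degen hg ?_
  have := restrict_mem (hh g) A u
  rwa [sdiff_sdiff_comm] at this

/-- The values of the forms of `S` at a common zero of `Z`. -/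
noncomputable def valuesOnZeros (Z S : Finset (Form n)) : Set (S → ZMod 2) :=
  {c | ∃ u, (∀ g ∈ Z, g.2 u = 0) ∧ ∀ j : S, j.1.2 u = c j}

/-- The terms of an element of `degen I H` are split into those with `h.1 = T` and the others. -/
lemma exists_split {H : Finset (Form n)} {r : Tup n → ZMod 2} (T : Finset (Fin d))
    (hr : r ∈ degen I H) :
    ∃ b : (H.filter fun h => h.1 = T) → Tup n → ZMod 2, (∀ j, b j ∈ multilin n (I \ T)) ∧
      r - ∑ j, j.1.2 * b j ∈ degen I (H.filter fun h => h.1 ≠ T) := by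
  obtain ⟨b, hb, rfl⟩ := mem_degen_iff.1 hr
  refine ⟨fun j => b j.1, fun j => ?_, ?_⟩
  · have := hb j.1
    rwa [(mem_filter.1 j.2).2] at this
  · rw [← sum_filter_add_sum_filter_not H (fun h => h.1 = T),
      sum_coe_sort (H.filter fun h => h.1 = T) (fun h => h.2 * b h), add_sub_cancel_left]
    exact Submodule.sum_mem _ fun g hg => mul_mem_degen hg (hb g)

/-- The slices of the cofactors of the terms with `h.1 = T`, weighted by the values of these terms
at a suitable point `u`, are degenerate. -/
lemma slice_combination_mem {I₀ : Finset (Fin d)} {i₀ : Fin d} (hi₀ : i₀ ∉ I₀) (hT : T ⊆ I₀)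
    {G H : Finset (Form n)} {r : Tup n → ZMod 2} (hG : Valid I₀ G)
    (hH : ∀ h ∈ H, h.1 ⊆ I₀ ∧ h.2 ∈ multilin n h.1 ∧ (h.1 ⊆ T → h.1 = T))
    {b : (H.filter fun h => h.1 = T) → Tup n → ZMod 2}
    (hb : ∀ j, b j ∈ multilin n (insert i₀ I₀ \ T))
    (hrb : r - ∑ j, j.1.2 * b j ∈ degen (insert i₀ I₀) (H.filter fun h => h.1 ≠ T))
    (u : Tup n) (hu : ∀ g ∈ G, g.1 ⊆ T → g.2 u = 0) (hr : slice i₀ (u i₀) r ∈ degen I₀ G) :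
    restrict {i₀} u (∑ j : (H.filter fun h => h.1 = T), j.1.2 u • b j) ∈
      degen (I₀ \ T) (restrictForms T u G ∪ restrictForms T u (H.filter fun h => h.1 ≠ T)) := by
  have hi₀T : i₀ ∉ T := fun h => hi₀ (hT h)
  rw [← restrict_singleton_eq_slice] at hr
  have h1 := restrict_mem_degen (A := T) (u := u) (fun g hg => (hG g hg).2.2) hu hr
  have h2 := restrict_mem_degen_of_disjoint (A := {i₀}) (fun h hh => by
    have := hH h (mem_filter.1 hh).1
    exact ⟨disjoint_singleton_right.2 fun h' => hi₀ (this.1 h'), this.2.1⟩) u hrb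
  have h3 := restrict_mem_degen (A := T) (u := u)
    (fun h hh => (hH h (mem_filter.1 hh).1).2.1)
    (fun h hh h' => absurd ((hH h (mem_filter.1 hh).1).2.2 h') (mem_filter.1 hh).2) h2
  rw [sdiff_singleton_eq_erase, erase_insert hi₀] at h3
  have h4 : restrict T u (restrict {i₀} u (∑ j : (H.filter fun h => h.1 = T), j.1.2 * b j)) =
      restrict {i₀} u (∑ j : (H.filter fun h => h.1 = T), j.1.2 u • b j) := by
    simp only [map_sum, map_smul]
    refine sum_congr rfl fun j _ => ?_
    obtain ⟨hjH, hjT⟩ := mem_filter.1 j.2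
    have hj := (hH j.1 hjH).2.1
    rw [hjT] at hj
    rw [restrict_mul, restrict_mul, restrict_of_disjoint hj (disjoint_singleton_right.2 hi₀T),
      restrict_of_subset hj subset_rfl, restrict_of_disjoint (restrict_mem (hb j) {i₀} u)]
    · rfl
    · exact disjoint_of_subset_left sdiff_subset sdiff_disjoint
  rw [← h4, degen_union]
  have h5 := Submodule.sub_mem_sup h1 h3
  rwa [← map_sub, ← map_sub, sub_sub_cancel] at h5

/-- The points at which the slice is `y ∈ Y` and the forms have prescribed values are dense. -/
lemma density_fibered_level_set {i₀ : Fin d} (hi₀ : i₀ ∉ T) {L K : ℕ} {η : ℝ}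
    (Y : Finset (Fin (n i₀) → ZMod 2)) (hY : η * Fintype.card (Fin (n i₀) → ZMod 2) ≤ Y.card)
    (Z : (Fin (n i₀) → ZMod 2) → Finset (Form n)) (S : Finset (Form n))
    (hZL : ∀ y, (Z y).card ≤ L) (hSK : S.card ≤ K)
    (hZ : ∀ y, ∀ g ∈ Z y, ∃ J ⊆ T, g.2 ∈ multilin n J) (hS : ∀ g ∈ S, ∃ J ⊆ T, g.2 ∈ multilin n J)
    (c : S → ZMod 2) (hc : ∀ y ∈ Y, c ∈ valuesOnZeros (Z y) S) :
    η * (1 / 2) ^ ((L + K) * d) * Fintype.card (Tup n) ≤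
      (univ.filter fun u : Tup n => u i₀ ∈ Y ∧ (∀ g ∈ Z (u i₀), g.2 u = 0) ∧
        ∀ j : S, j.1.2 u = c j).card := by
  set N : ℝ := (Fintype.card (Tup n) : ℝ) with hN
  set D : ℝ := (Fintype.card (Fin (n i₀) → ZMod 2) : ℝ) with hD
  have hD0 : 0 < D := by rw [hD]; exact_mod_cast Fintype.card_pos
  set σ : ℝ := (1 / 2 : ℝ) ^ ((L + K) * d) with hσ
  have hσ0 : 0 < σ := by positivity
  set E := univ.filter fun u : Tup n => u i₀ ∈ Y ∧ (∀ g ∈ Z (u i₀), g.2 u = 0) ∧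
        ∀ j : S, j.1.2 u = c j with hE
  have hupd : ∀ g : Form n, (∃ J ⊆ T, g.2 ∈ multilin n J) → ∀ (u : Tup n) y,
      g.2 (update u i₀ y) = g.2 u := fun g ⟨J, hJT, hJ⟩ u y =>
    multilin_update_of_notMem hJ (fun h => hi₀ (hJT h)) u y
  have hfib : ∀ y ∈ Y, σ * N ≤ (univ.filter fun u : Tup n => update u i₀ y ∈ E).card := by
    intro y hy
    obtain ⟨u₀, hu₀Z, hu₀S⟩ := hc y hy
    refine (density_level_set (L := L + K) ((Z y).image Prod.snd ∪ S.image Prod.snd) ?_ ?_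
      u₀).trans ?_
    · exact (card_union_le _ _).trans
        (Nat.add_le_add (card_image_le.trans (hZL y)) (card_image_le.trans hSK))
    · intro g hg
      rcases mem_union.1 hg with hg | hg
      · obtain ⟨g', hg', rfl⟩ := mem_image.1 hg
        obtain ⟨J, -, hJ⟩ := hZ y g' hg'
        exact ⟨J, hJ⟩
      · obtain ⟨g', hg', rfl⟩ := mem_image.1 hg
        obtain ⟨J, -, hJ⟩ := hS g' hg'
        exact ⟨J, hJ⟩
    · norm_cast
      refine card_le_card fun u hu => ?_
      replace hu := (mem_filter.1 hu).2
      refine mem_filter.2 ⟨mem_univ _, mem_filter.2 ⟨mem_univ _, ?_, ?_, ?_⟩⟩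
      · rwa [update_self]
      · rw [update_self]
        intro g hg
        rw [hupd g (hZ y g hg), hu g.2 (mem_union_left _ (mem_image_of_mem _ hg)), hu₀Z g hg]
      · intro j
        rw [hupd j.1 (hS j.1 j.2), hu j.1.2 (mem_union_right _ (mem_image_of_mem _ j.2)), hu₀S j]
  have h1 := sum_sum_update' (n := n) i₀ fun u => if u ∈ E then (1 : ℝ) else 0
  simp only [sum_boole, filter_mem_eq_inter, univ_inter, nsmul_eq_mul] at h1
  have h2 : (Y.card : ℝ) * (σ * N) ≤ ∑ y ∈ Y, ((univ.filter fun u : Tup n =>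
      update u i₀ y ∈ E).card : ℝ) := by
    rw [← nsmul_eq_mul]; exact card_nsmul_le_sum _ _ _ hfib
  have h3 : ∑ y ∈ Y, ((univ.filter fun u : Tup n => update u i₀ y ∈ E).card : ℝ) ≤ D * E.card := by
    rw [hD, ← h1]
    exact sum_le_sum_of_subset_of_nonneg (subset_univ _) fun _ _ _ => by positivity
  have h4 : η * D * (σ * N) ≤ Y.card * (σ * N) := by
    have : 0 ≤ N := by rw [hN]; positivity
    gcongr
  have h5 : D * (η * σ * N) ≤ D * E.card := by
    calc D * (η * σ * N) = η * D * (σ * N) := by ring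
      _ ≤ _ := by linarith
  exact le_of_mul_le_mul_left h5 hD0

/-- Suppose that the axis sets of the forms `H` contain no proper subset of `T`. If the
slices of `r ∈ degen H` are often degenerate, then the forms with axis set `T` can be replaced by
forms with larger axis sets, up to a degenerate space that does not depend on `r`.

Write `r = ∑ v j ⊗ b j + …` with `v j ∈ 𝔽₂^T`. Combinations of the `v j` that vanish on the zeros
of the forms `G y` for many `y` lie in a fixed degenerate space. Modulo these, the values `c` which
`(v j)` often takes on such zeros span all values, and for these the combination `∑ c j • b j` is
covered by `exists_net_of_dense_slices`. -/
lemma exists_degen_replace {I₀ : Finset (Fin d)} {i₀ i₁ : Fin d} (hi₀ : i₀ ∉ I₀) (hT : T ⊆ I₀)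
    (hi₁ : i₁ ∈ I₀ \ T) (hMT : MostlyZeroDegenerate T)
    (hMR : MostlyZeroDegenerate (insert i₀ ((I₀ \ T).erase i₁))) (L K : ℕ) {β : ℝ} (hβ : 0 < β) :
    ∃ C K' : ℕ, ∀ (n : Fin d → ℕ) (G : (Fin (n i₀) → ZMod 2) → Finset (Form n)),
      (∀ y, Valid I₀ (G y)) → (∀ y, (G y).card ≤ L) →
      ∃ G' : Finset (Form n), Valid (insert i₀ I₀) G' ∧ G'.card ≤ C ∧ (∀ g ∈ G', g.1 ≠ {i₀}) ∧
        ∀ (r : Tup n → ZMod 2) (H : Finset (Form n)), H.card ≤ K →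
          (∀ h ∈ H, h.1 ⊆ I₀ ∧ h.2 ∈ multilin n h.1 ∧ (h.1 ⊆ T → h.1 = T)) →
          r ∈ degen (insert i₀ I₀) H →
          β * Fintype.card (Fin (n i₀) → ZMod 2) ≤
            (univ.filter fun y => slice i₀ y r ∈ degen I₀ (G y)).card →
          ∃ H' : Finset (Form n), H'.card ≤ K' ∧
            (∀ h ∈ H', h.1 ⊆ I₀ ∧ h.2 ∈ multilin n h.1 ∧
              (T ⊂ h.1 ∨ h.1 ≠ T ∧ ∃ h₀ ∈ H, h₀.1 = h.1)) ∧
            r ∈ degen (insert i₀ I₀) G' ⊔ degen (insert i₀ I₀) H' := by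
  have hi₀T : i₀ ∉ T := fun h => hi₀ (hT h)
  have hi₀R : i₀ ∉ I₀ \ T := fun h => hi₀ (mem_sdiff.1 h).1
  have hR : insert i₀ I₀ \ T = insert i₀ (I₀ \ T) := insert_sdiff_of_notMem _ hi₀T
  have hTI : T ⊆ insert i₀ I₀ := hT.trans (subset_insert _ _)
  set η : ℝ := β / 2 / 2 ^ K with hη
  have hη0 : 0 < η := by positivity
  obtain ⟨C₁, hC₁⟩ := exists_degen_of_vanishing hMT L (τ := β / 2) (by positivity)
  obtain ⟨m, C₂, hC₂⟩ := exists_net_of_dense_slices hi₀R hi₁ hMR (L + K)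
    (κ := η * (1 / 2) ^ ((L + K) * d)) (by positivity)
  refine ⟨C₁ + m, K + K * (2 ^ K * C₂), fun n G hG hGL => ?_⟩
  let GT : (Fin (n i₀) → ZMod 2) → Finset (Form n) := fun y => (G y).filter fun g => g.1 ⊆ T
  obtain ⟨G₁, hG₁, hG₁C, hG₁v⟩ := hC₁ n (Fin (n i₀) → ZMod 2) GT
    (fun y => (card_filter_le _ _).trans (hGL y))
    (fun y g hg => (hG y g (mem_filter.1 hg).1).2)
  obtain ⟨W, hWm, hWR, hW⟩ := hC₂ n (fun u => restrictForms T u (G (u i₀)))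
    (fun u => Valid.restrictForms (fun g hg => ⟨(hG _ g hg).1, (hG _ g hg).2.2⟩) u)
    (fun u => (card_restrictForms_le _ _).trans ((hGL _).trans (Nat.le_add_right _ _)))
  let G₂ : Finset (Form n) := W.image fun w => (insert i₀ I₀ \ T, w)
  have hG₂ : Valid (insert i₀ I₀) G₂ := by
    intro g hg
    obtain ⟨w, hw, rfl⟩ := mem_image.1 hg
    refine ⟨sdiff_subset, ⟨i₀, mem_sdiff.2 ⟨mem_insert_self _ _, hi₀T⟩⟩, ?_⟩
    rw [hR]; exact hWR w hw
  refine ⟨G₁ ∪ G₂, (hG₁.mono_left hTI).union hG₂,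
    (card_union_le _ _).trans (Nat.add_le_add hG₁C (card_image_le.trans hWm)), ?_, ?_⟩
  · intro g hg hgi
    rcases mem_union.1 hg with hg | hg
    · exact hi₀T ((hG₁ g hg).1 (hgi ▸ mem_singleton_self i₀))
    · obtain ⟨w, hw, rfl⟩ := mem_image.1 hg
      have h1 : i₁ ∈ insert i₀ I₀ \ T := by rw [hR]; exact mem_insert_of_mem hi₁
      rw [show insert i₀ I₀ \ T = {i₀} from hgi, mem_singleton] at h1
      exact hi₀R (h1 ▸ hi₁)
  intro r H hHK hH hr hdense
  set D : ℝ := (Fintype.card (Fin (n i₀) → ZMod 2) : ℝ) with hD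
  set Y := univ.filter fun y => slice i₀ y r ∈ degen I₀ (G y) with hY
  set S := H.filter fun h => h.1 = T with hS
  have hSK : S.card ≤ K := (card_filter_le _ _).trans hHK
  have hST : ∀ j : S, j.1.2 ∈ multilin n T := fun j => by
    have h1 := mem_filter.1 j.2
    have h2 := (hH j.1 h1.1).2.1
    rwa [h1.2] at h2
  obtain ⟨b, hb, hrb⟩ := exists_split T hr
  -- the values that are often taken
  let Γ : Set (S → ZMod 2) := {c | η * D ≤ (Y.filter fun y => c ∈ valuesOnZeros (GT y) S).card}
  have hcardS : ((Fintype.card (S → ZMod 2) : ℕ) : ℝ) ≤ 2 ^ K := by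
    rw [Fintype.card_fun, ZMod.card, Fintype.card_coe]
    push_cast
    exact pow_le_pow_right₀ one_le_two hSK
  have hperp : ∀ a : S → ZMod 2, (∀ c ∈ Γ, ∑ j, a j * c j = 0) →
      ∑ j, a j • j.1.2 ∈ degen T G₁ := by
    intro a ha
    refine hG₁v _ (Submodule.sum_mem _ fun j _ => Submodule.smul_mem _ _ (hST j)) ?_
    by_contra! hlt
    -- otherwise, for many `y ∈ Y` there is a value not orthogonal to `a`
    set Bad := univ.filter fun y => ∀ u, (∀ g ∈ GT y, g.2 u = 0) →
      (∑ j : S, a j • j.1.2) u = 0 with hBad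
    have h1 : β / 2 * D < (Y \ Bad).card := by
      have h2 : (Y.card : ℝ) ≤ (Y \ Bad).card + Bad.card := by
        exact_mod_cast card_le_card_sdiff_add_card
      linarith
    have h3 : Y \ Bad ⊆ (univ.filter fun c : S → ZMod 2 => c ∉ Γ).biUnion fun c =>
        Y.filter fun y => c ∈ valuesOnZeros (GT y) S := by
      intro y hy
      obtain ⟨hyY, hyB⟩ := mem_sdiff.1 hy
      rw [hBad, mem_filter] at hyB
      push Not at hyB
      obtain ⟨u, hu, hau⟩ := hyB (mem_univ _)
      refine mem_biUnion.2 ⟨fun j => j.1.2 u, mem_filter.2 ⟨mem_univ _, fun hc => hau ?_⟩,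
        mem_filter.2 ⟨hyY, u, hu, fun j => rfl⟩⟩
      have := ha _ hc
      simpa [Finset.sum_apply] using this
    have h4 : ((Y \ Bad).card : ℝ) ≤ ∑ c ∈ univ.filter fun c : S → ZMod 2 => c ∉ Γ,
        ((Y.filter fun y => c ∈ valuesOnZeros (GT y) S).card : ℝ) := by
      exact_mod_cast (card_le_card h3).trans card_biUnion_le
    have h5 : ∑ c ∈ univ.filter fun c : S → ZMod 2 => c ∉ Γ,
        ((Y.filter fun y => c ∈ valuesOnZeros (GT y) S).card : ℝ) ≤ 2 ^ K * (η * D) := by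
      refine (sum_le_card_nsmul _ _ (η * D) fun c hc => ?_).trans ?_
      · exact (not_le.1 (mem_filter.1 hc).2).le
      · rw [nsmul_eq_mul]
        refine mul_le_mul_of_nonneg_right (le_trans ?_ hcardS) (by positivity)
        exact_mod_cast card_le_univ _
    have h6 : 2 ^ K * (η * D) = β / 2 * D := by rw [hη]; field_simp
    linarith
  have hnet : ∀ c ∈ Γ, ∃ H' : Finset (Form n), Valid (I₀ \ T) H' ∧ H'.card ≤ C₂ ∧
      ∃ w ∈ W, (∑ j, c j • b j) - w ∈ degen (insert i₀ I₀ \ T) H' := by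
    intro c hc
    have hdens : η * (1 / 2) ^ ((L + K) * d) * Fintype.card (Tup n) ≤
        (univ.filter fun u => restrict {i₀} u (∑ j, c j • b j) ∈ degen (I₀ \ T)
          (restrictForms T u (G (u i₀)) ∪ restrictForms T u (H.filter fun h => h.1 ≠ T))).card := by
      refine (density_fibered_level_set hi₀T (L := L) (K := K) _ hc GT S
        (fun y => (card_filter_le _ _).trans (hGL y)) hSK
        (fun y g hg => ⟨g.1, (mem_filter.1 hg).2, (hG y g (mem_filter.1 hg).1).2.2⟩)
        (fun g hg => ⟨T, subset_rfl, hST ⟨g, hg⟩⟩) c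
        (fun y hy => (mem_filter.1 hy).2)).trans ?_
      norm_cast
      refine card_le_card fun u hu => ?_
      obtain ⟨hu1, hu2, hu3⟩ := (mem_filter.1 hu).2
      refine mem_filter.2 ⟨mem_univ _, ?_⟩
      have := slice_combination_mem hi₀ hT (hG (u i₀)) hH hb hrb u
        (fun g hg hgT => hu2 g (mem_filter.2 ⟨hg, hgT⟩))
        (mem_filter.1 (mem_filter.1 hu1).1).2
      simp only [hu3] at this
      exact this
    have hmem : ∑ j, c j • b j ∈ multilin n (insert i₀ (I₀ \ T)) := by
      rw [← hR]
      exact Submodule.sum_mem _ fun j _ => Submodule.smul_mem _ _ (hb j)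
    obtain ⟨w, hw, H', h1, h2, h3⟩ := hW (∑ j, c j • b j)
      (fun u => restrictForms T u (H.filter fun h => h.1 ≠ T)) hmem
      (fun u => Valid.restrictForms (fun h hh =>
        ⟨(hH h (mem_filter.1 hh).1).1, (hH h (mem_filter.1 hh).1).2.1⟩) u)
      (fun u => (card_restrictForms_le _ _).trans
        ((card_filter_le _ _).trans (hHK.trans (Nat.le_add_left _ _))))
      (fun u x => restrictForms_congr
        (fun i hi => update_of_ne (fun h : i = i₀ => hi₀T (h ▸ hi)) _ _) _) hdens
    rw [← hR] at h3
    exact ⟨H', h1, h2, w, hw, h3⟩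
  choose! HΓ hHΓ hHΓC hHΓW using hnet
  let H₁ : Finset (Form n) := (univ.filter fun c => c ∈ Γ).biUnion HΓ
  have hH₁ : Valid (I₀ \ T) H₁ := by
    intro h hh
    obtain ⟨c, hc, hh⟩ := mem_biUnion.1 hh
    exact hHΓ c (mem_filter.1 hc).2 h hh
  have hH₁C : H₁.card ≤ 2 ^ K * C₂ := by
    refine card_biUnion_le.trans ((sum_le_card_nsmul _ _ C₂ fun c hc =>
      hHΓC c (mem_filter.1 hc).2).trans ?_)
    rw [smul_eq_mul]
    refine Nat.mul_le_mul_right _ ((card_le_univ _).trans ?_)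
    exact_mod_cast hcardS
  -- the conclusion for `Γ` extends to its span
  have hspan : ∀ c ∈ Submodule.span (ZMod 2) Γ,
      ∑ j, c j • b j ∈ Submodule.span (ZMod 2) (W : Set (Tup n → ZMod 2)) ⊔
        degen (insert i₀ I₀ \ T) H₁ := by
    intro c hc
    induction hc using Submodule.span_induction with
    | mem c hc =>
      obtain ⟨w, hw, h⟩ := hHΓW c hc
      have hsub : HΓ c ⊆ H₁ := fun h hh => mem_biUnion.2 ⟨c, mem_filter.2 ⟨mem_univ _, hc⟩, hh⟩
      have := Submodule.add_mem_sup (Submodule.subset_span (R := ZMod 2) (mem_coe.2 hw))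
        (degen_mono hsub h)
      rwa [add_sub_cancel] at this
    | zero => simp
    | add x y _ _ hx hy =>
      simp only [Pi.add_apply, add_smul, sum_add_distrib]
      exact Submodule.add_mem _ hx hy
    | smul a x _ hx =>
      simp only [Pi.smul_apply, smul_assoc, ← smul_sum]
      exact Submodule.smul_mem _ _ hx
  obtain ⟨P, hP, hP', hPsum⟩ := exists_projection (n := n) (Submodule.span (ZMod 2) Γ)
  let H₂ : Finset (Form n) := univ.biUnion fun j : S => mulForms T j.1.2 H₁
  refine ⟨(H.filter fun h => h.1 ≠ T) ∪ H₂, ?_, ?_, ?_⟩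
  · refine (card_union_le _ _).trans (Nat.add_le_add ((card_filter_le _ _).trans hHK) ?_)
    refine card_biUnion_le.trans ((sum_le_card_nsmul _ _ (2 ^ K * C₂) fun j _ =>
      card_image_le.trans hH₁C).trans ?_)
    rw [smul_eq_mul, card_univ, Fintype.card_coe]
    exact Nat.mul_le_mul_right _ hSK
  · intro h hh
    rcases mem_union.1 hh with hh | hh
    · obtain ⟨hh, hhT⟩ := mem_filter.1 hh
      exact ⟨(hH h hh).1, (hH h hh).2.1, Or.inr ⟨hhT, h, hh, rfl⟩⟩
    · obtain ⟨j, -, hh⟩ := mem_biUnion.1 hh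
      obtain ⟨h', hh', rfl⟩ := mem_image.1 hh
      obtain ⟨h1, ⟨x, hx⟩, h3⟩ := hH₁ h' hh'
      refine ⟨union_subset hT (h1.trans sdiff_subset),
        mul_mem_multilin (hST j) h3 (disjoint_of_subset_right h1 disjoint_sdiff), Or.inl ?_⟩
      exact ⟨subset_union_left, fun h =>
        (mem_sdiff.1 (h1 hx)).2 (h (mem_union_right _ hx))⟩
  · set M := degen (insert i₀ I₀) (G₁ ∪ G₂) ⊔
      degen (insert i₀ I₀) ((H.filter fun h => h.1 ≠ T) ∪ H₂) with hM
    have hMG : degen (insert i₀ I₀) (G₁ ∪ G₂) ≤ M := le_sup_left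
    have hMH : degen (insert i₀ I₀) ((H.filter fun h => h.1 ≠ T) ∪ H₂) ≤ M := le_sup_right
    have hfirst : ∀ j : S, j.1.2 * ∑ i, P j i • b i ∈ M := by
      intro j
      obtain ⟨w, hw, f, hf, he⟩ := Submodule.mem_sup.1 (hspan (P j) (hP j))
      rw [← he, mul_add]
      refine Submodule.add_mem _ ?_ ?_
      · have hle : Submodule.span (ZMod 2) (W : Set (Tup n → ZMod 2)) ≤
            M.comap (LinearMap.mulLeft (ZMod 2) j.1.2) := by
          refine Submodule.span_le.2 fun w hw => hMG (degen_mono subset_union_right ?_)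
          have hwG : (insert i₀ I₀ \ T, w) ∈ G₂ := mem_image.2 ⟨w, mem_coe.1 hw, rfl⟩
          have hj : j.1.2 ∈ multilin n (insert i₀ I₀ \ (insert i₀ I₀ \ T)) := by
            rw [Finset.sdiff_sdiff_eq_self hTI]; exact hST j
          have := mul_mem_degen hwG hj
          rwa [mul_comm] at this
        exact hle hw
      · refine hMH (degen_mono (subset_union_right.trans' ?_) (mul_degen_mem hf))
        exact subset_biUnion_of_mem (fun j : S => mulForms T j.1.2 H₁) (mem_univ j)
    have hsecond : ∀ i : S,
        (∑ j : S, ((Pi.single i 1 : S → ZMod 2) j - P j i) • j.1.2) * b i ∈ M := by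
      intro i
      refine hMG (degen_mono subset_union_left (degen_mul_mem hG₁ hTI (hperp _ fun c hc => ?_)
        (hb i)))
      exact hP' c (Submodule.subset_span hc) i
    have hsum : ∑ j : S, j.1.2 * b j ∈ M := by
      rw [hPsum]
      exact Submodule.add_mem _ (Submodule.sum_mem _ fun j _ => hfirst j)
        (Submodule.sum_mem _ fun i _ => hsecond i)
    have := Submodule.add_mem _ hsum (hMH (degen_mono subset_union_left hrb))
    rwa [add_sub_cancel] at this

/-! ### The induction on the number of axes -/

/-- When only forms with all axes of `I₀` remain, `r = ∑ v j ⊗ b j` with linear forms `b j` in the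
axis `i₀`. For most `y` the values `(b j y)` lie in the space of those `c` for which
`∑ c j • v j` belongs to a fixed degenerate space. Hence the linear combinations of the `b j` that
annihilate this space vanish at most `y`, and there are boundedly many such linear forms. -/
lemma exists_degen_of_full {I₀ : Finset (Fin d)} {i₀ : Fin d} (hi₀ : i₀ ∉ I₀)
    (hM : MostlyZeroDegenerate I₀) (L K : ℕ) {δ : ℝ} (hδ : 0 < δ) :
    ∃ C : ℕ, ∀ (n : Fin d → ℕ) (G : (Fin (n i₀) → ZMod 2) → Finset (Form n)),
      (∀ y, Valid I₀ (G y)) → (∀ y, (G y).card ≤ L) →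
      ∀ W : (Fin (n i₀) → ZMod 2) → ℝ, (∀ y, 0 ≤ W y) → (∀ y, W y ≤ 1) →
        δ * Fintype.card (Fin (n i₀) → ZMod 2) ≤ ∑ y, W y →
      ∃ G' : Finset (Form n), Valid (insert i₀ I₀) G' ∧ G'.card ≤ C ∧
        ∀ (r : Tup n → ZMod 2) (H : Finset (Form n)), H.card ≤ K →
          (∀ h ∈ H, h.1 = I₀ ∧ h.2 ∈ multilin n h.1) → r ∈ degen (insert i₀ I₀) H →
          ∑ y with slice i₀ y r ∉ degen I₀ (G y), W y ≤ 1 / 8 * ∑ y, W y →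
          r ∈ degen (insert i₀ I₀) G' := by
  set τ : ℝ := δ / 8 / 2 ^ K with hτ
  obtain ⟨C₁, hC₁⟩ := exists_degen_of_vanishing hM L (τ := τ) (by positivity)
  obtain ⟨C₂, hC₂⟩ := exists_nat_ge (4 / δ)
  refine ⟨C₁ + C₂, fun n G hG hGL W hW0 hW1 hW => ?_⟩
  obtain ⟨G₁, hG₁, hG₁C, hG₁v⟩ := hC₁ n (Fin (n i₀) → ZMod 2) G hGL fun y g hg => (hG y g hg).2
  set s := ∑ y, W y with hs
  let V : Finset (Tup n → ZMod 2) := univ.filter fun b => b ∈ multilin n {i₀} ∧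
    ∑ y with b (update 0 i₀ y) ≠ 0, W y ≤ 1 / 4 * s
  have hVC : V.card ≤ C₂ := by
    have := card_mostlyZero_linear hδ W hW0 hW1 hW V fun b hb => (mem_filter.1 hb).2
    exact_mod_cast this.trans hC₂
  let G₂ : Finset (Form n) := V.image fun b => ({i₀}, b)
  have hG₂ : Valid (insert i₀ I₀) G₂ := by
    intro g hg
    obtain ⟨b, hb, rfl⟩ := mem_image.1 hg
    exact ⟨by simp, singleton_nonempty _, (mem_filter.1 hb).2.1⟩
  have hsub : I₀ ⊆ insert i₀ I₀ := subset_insert _ _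
  have hdiff : insert i₀ I₀ \ I₀ = {i₀} := by
    rw [insert_sdiff_of_notMem _ hi₀, sdiff_self]; rfl
  have hdiff' : insert i₀ I₀ \ {i₀} = I₀ := by rw [sdiff_singleton_eq_erase, erase_insert hi₀]
  refine ⟨G₁ ∪ G₂, (hG₁.mono_left hsub).union hG₂,
    (card_union_le _ _).trans (Nat.add_le_add hG₁C (card_image_le.trans hVC)), ?_⟩
  intro r H hHK hH hr hbad
  set S := H.filter fun h => h.1 = I₀ with hS
  obtain ⟨b, hb, hrb⟩ := exists_split I₀ hr
  rw [hdiff] at hb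
  have hSK : S.card ≤ K := (card_filter_le _ _).trans hHK
  have hSI : ∀ j : S, j.1.2 ∈ multilin n I₀ := fun j => by
    have h1 := hH j.1 (mem_filter.1 j.2).1
    have h2 := h1.2
    rwa [h1.1] at h2
  have hr' : r = ∑ j : S, j.1.2 * b j := by
    have hem : (H.filter fun h => h.1 ≠ I₀) = ∅ :=
      filter_false_of_mem fun h hh => not_not.2 (hH h hh).1
    rw [hem] at hrb
    have : r - ∑ j : S, j.1.2 * b j = 0 := by simpa [degen] using hrb
    exact sub_eq_zero.1 this
  -- the values `c` of `(b j)` that are harmless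
  let Λ : Submodule (ZMod 2) (S → ZMod 2) :=
    (degen I₀ G₁).comap (Fintype.linearCombination (ZMod 2) fun j : S => j.1.2)
  have hΛ : ∀ c, c ∈ Λ ↔ ∑ j, c j • j.1.2 ∈ degen I₀ G₁ := fun c => by
    rw [Submodule.mem_comap, Fintype.linearCombination_apply]
  have hslice : ∀ y, slice i₀ y r = ∑ j : S, b j (update 0 i₀ y) • j.1.2 := by
    intro y
    rw [hr', map_sum]
    refine sum_congr rfl fun j _ => ?_
    rw [restrict_mul, restrict_of_disjoint (hSI j) (disjoint_singleton_right.2 hi₀),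
      restrict_of_subset (hb j) subset_rfl]
    funext t
    simp [mul_comm]
  let Bad : (S → ZMod 2) → Finset (Fin (n i₀) → ZMod 2) := fun c =>
    univ.filter fun y => ∀ u, (∀ g ∈ G y, g.2 u = 0) → (∑ j : S, c j • j.1.2) u = 0
  have hcover : (univ.filter fun y => (fun j => b j (update 0 i₀ y)) ∉ Λ) ⊆
      (univ.filter fun y => slice i₀ y r ∉ degen I₀ (G y)) ∪
        (univ.filter fun c => c ∉ Λ).biUnion Bad := by
    intro y hy
    by_cases hy' : slice i₀ y r ∈ degen I₀ (G y)
    · refine mem_union_right _ (mem_biUnion.2 ⟨_, mem_filter.2 ⟨mem_univ _, (mem_filter.1 hy).2⟩,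
        mem_filter.2 ⟨mem_univ _, fun u hu => ?_⟩⟩)
      rw [← hslice]
      exact apply_eq_zero_of_mem_degen hy' hu
    · exact mem_union_left _ (mem_filter.2 ⟨mem_univ _, hy'⟩)
  set D : ℝ := (Fintype.card (Fin (n i₀) → ZMod 2) : ℝ) with hD
  have hBad : ∀ c ∉ Λ, ((Bad c).card : ℝ) ≤ τ * D := by
    intro c hc
    by_contra! hlt
    refine hc ((hΛ c).2 (hG₁v _ (Submodule.sum_mem _ fun j _ =>
      Submodule.smul_mem _ _ (hSI j)) ?_))
    exact hlt.le
  have hmass : ∑ y with (fun j => b j (update 0 i₀ y)) ∉ Λ, W y ≤ 1 / 4 * s := by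
    have h1 : ∑ y ∈ (univ.filter fun c => c ∉ Λ).biUnion Bad, W y ≤ δ / 8 * D := by
      calc ∑ y ∈ (univ.filter fun c => c ∉ Λ).biUnion Bad, W y
          ≤ ∑ _y ∈ (univ.filter fun c => c ∉ Λ).biUnion Bad, (1 : ℝ) :=
            sum_le_sum fun y _ => hW1 y
        _ = (((univ.filter fun c => c ∉ Λ).biUnion Bad).card : ℝ) := by simp
        _ ≤ ∑ c ∈ univ.filter (fun c => c ∉ Λ), ((Bad c).card : ℝ) := by
            exact_mod_cast card_biUnion_le
        _ ≤ (univ.filter fun c => c ∉ Λ).card • (τ * D) :=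
            sum_le_card_nsmul _ _ _ fun c hc => hBad c (mem_filter.1 hc).2
        _ ≤ 2 ^ K * (τ * D) := by
            rw [nsmul_eq_mul]
            refine mul_le_mul_of_nonneg_right ?_ (by positivity)
            have h2 : (univ.filter fun c => c ∉ Λ).card ≤ 2 ^ K := by
              refine (card_le_univ _).trans ?_
              rw [Fintype.card_fun, ZMod.card, Fintype.card_coe]
              exact Nat.pow_le_pow_right two_pos hSK
            exact_mod_cast h2
        _ = δ / 8 * D := by rw [hτ]; field_simp
    have h2 := sum_le_sum_of_subset_of_nonneg hcover fun y _ _ => hW0 y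
    have h3 := sum_union_inter (s₁ := univ.filter fun y => slice i₀ y r ∉ degen I₀ (G y))
      (s₂ := (univ.filter fun c => c ∉ Λ).biUnion Bad) (f := W)
    have h4 : 0 ≤ ∑ y ∈ (univ.filter fun y => slice i₀ y r ∉ degen I₀ (G y)) ∩
        (univ.filter fun c => c ∉ Λ).biUnion Bad, W y := sum_nonneg fun y _ => hW0 y
    linarith
  obtain ⟨P, hP, hP', hPsum⟩ := exists_projection (n := n) Λ
  have hfirst : ∀ j : S, b j * ∑ i, P j i • i.1.2 ∈ degen (insert i₀ I₀) (G₁ ∪ G₂) := by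
    intro j
    rw [mul_comm]
    refine degen_mono subset_union_left (degen_mul_mem hG₁ hsub ((hΛ _).1 (hP j)) ?_)
    rw [hdiff]; exact hb j
  have hsecond : ∀ i : S, (∑ j : S, ((Pi.single i 1 : S → ZMod 2) j - P j i) • b j) * i.1.2 ∈
      degen (insert i₀ I₀) (G₁ ∪ G₂) := by
    intro i
    set f := ∑ j : S, ((Pi.single i 1 : S → ZMod 2) j - P j i) • b j with hf
    have hfV : f ∈ V := by
      refine mem_filter.2 ⟨mem_univ _, Submodule.sum_mem _ fun j _ =>
        Submodule.smul_mem _ _ (hb j), le_trans ?_ hmass⟩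
      refine sum_le_sum_of_subset_of_nonneg (fun y hy => ?_) fun y _ _ => hW0 y
      refine mem_filter.2 ⟨mem_univ _, fun hc => (mem_filter.1 hy).2 ?_⟩
      have := hP' _ hc i
      simpa [hf, Finset.sum_apply] using this
    have hfG : (({i₀}, f) : Form n) ∈ G₂ := mem_image.2 ⟨f, hfV, rfl⟩
    refine degen_mono subset_union_right (mul_mem_degen (I := insert i₀ I₀) hfG ?_)
    rw [hdiff']; exact hSI i
  have hcomm : r = ∑ j : S, b j * j.1.2 := by
    rw [hr']; exact sum_congr rfl fun j _ => mul_comm _ _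
  rw [hcomm, hPsum b fun j => j.1.2]
  exact Submodule.add_mem _ (Submodule.sum_mem _ fun j _ => hfirst j)
    (Submodule.sum_mem _ fun i _ => hsecond i)

/-- The slices of the elements of a fixed degenerate space can be absorbed into the degenerate
spaces of the slices, unless forms in the single axis `i₀` occur. -/
lemma slice_mem_degen {I₀ : Finset (Fin d)} {i₀ : Fin d} (hi₀ : i₀ ∉ I₀) {G : Finset (Form n)}
    (hG : Valid (insert i₀ I₀) G) (hGi : ∀ g ∈ G, g.1 ≠ {i₀}) (y : Fin (n i₀) → ZMod 2)
    {x : Tup n → ZMod 2} (hx : x ∈ degen (insert i₀ I₀) G) :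
    slice i₀ y x ∈ degen I₀ (restrictForms {i₀} (update 0 i₀ y) G) := by
  have := restrict_mem_degen (A := {i₀}) (u := update 0 i₀ y) (fun g hg => (hG g hg).2.2)
    (fun g hg h => absurd ((subset_singleton_iff.1 h).resolve_left
      (hG g hg).2.1.ne_empty) (hGi g hg)) hx
  rwa [sdiff_singleton_eq_erase, erase_insert hi₀] at this

lemma valid_slice {I₀ : Finset (Fin d)} {i₀ : Fin d} (hi₀ : i₀ ∉ I₀) {G : Finset (Form n)}
    (hG : Valid (insert i₀ I₀) G) (y : Fin (n i₀) → ZMod 2) :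
    Valid I₀ (restrictForms {i₀} (update 0 i₀ y) G) := by
  have := Valid.restrictForms (A := {i₀}) (fun g hg => ⟨(hG g hg).1, (hG g hg).2.2⟩)
    (update 0 i₀ y)
  rwa [sdiff_singleton_eq_erase, erase_insert hi₀] at this

/-- Iterating `exists_degen_replace` over a family `𝒟` of proper subsets of `I₀` that is closed
under subsets: arrays with many degenerate slices are, modulo a fixed degenerate space, given by
forms whose axis sets are not in `𝒟`. -/
lemma exists_degen_iterate {I₀ : Finset (Fin d)} {i₀ : Fin d} (hi₀ : i₀ ∉ I₀)
    (hM : ∀ J : Finset (Fin d), J.card ≤ I₀.card → MostlyZeroDegenerate J) (L : ℕ) {β : ℝ}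
    (hβ : 0 < β) (m : ℕ) : ∀ 𝒟 : Finset (Finset (Fin d)), 𝒟.card = m → 𝒟 ⊆ I₀.ssubsets →
      (∀ T ∈ 𝒟, ∀ T' ⊆ T, T' ∈ 𝒟) →
    ∃ C K : ℕ, ∀ (n : Fin d → ℕ) (G : (Fin (n i₀) → ZMod 2) → Finset (Form n)),
      (∀ y, Valid I₀ (G y)) → (∀ y, (G y).card ≤ L) →
      ∃ G' : Finset (Form n), Valid (insert i₀ I₀) G' ∧ G'.card ≤ C ∧ (∀ g ∈ G', g.1 ≠ {i₀}) ∧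
        ∀ r ∈ multilin n (insert i₀ I₀),
          β * Fintype.card (Fin (n i₀) → ZMod 2) ≤
            (univ.filter fun y => slice i₀ y r ∈ degen I₀ (G y)).card →
          ∃ H : Finset (Form n), H.card ≤ K ∧
            (∀ h ∈ H, h.1 ⊆ I₀ ∧ h.2 ∈ multilin n h.1 ∧ h.1 ∉ 𝒟) ∧
            r ∈ degen (insert i₀ I₀) G' ⊔ degen (insert i₀ I₀) H := by
  induction m with
  | zero =>
    intro 𝒟 h𝒟 _ _
    rw [card_eq_zero] at h𝒟
    subst h𝒟
    refine ⟨0, 1, fun n G _ _ => ⟨∅, by simp [Valid], by simp, by simp, fun r hr _ => ?_⟩⟩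
    -- every array is a multiple of the form without axes
    refine ⟨{(∅, 1)}, by simp, ?_, ?_⟩
    · intro h hh
      rw [mem_singleton] at hh
      subst hh
      exact ⟨empty_subset _, one_mem_multilin, notMem_empty _⟩
    · refine Submodule.mem_sup_right ?_
      have h1 : ((∅, 1) : Form n) ∈ ({(∅, 1)} : Finset (Form n)) := mem_singleton_self _
      have h2 : r ∈ multilin n (insert i₀ I₀ \ ∅) := by rwa [sdiff_empty]
      have := mul_mem_degen h1 h2
      rwa [one_mul] at this
  | succ m ih =>
    intro 𝒟 hm h𝒟 hdown
    obtain ⟨T, hT𝒟, hTmax⟩ := exists_max_image 𝒟 card (card_pos.1 (by omega))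
    have hTss := mem_ssubsets.1 (h𝒟 hT𝒟)
    obtain ⟨C₁, K₁, h₁⟩ := ih (𝒟.erase T) (by rw [card_erase_of_mem hT𝒟]; omega)
      ((erase_subset _ _).trans h𝒟) (fun T' hT' T'' hT'' => by
        obtain ⟨hne, hT'𝒟⟩ := mem_erase.1 hT'
        refine mem_erase.2 ⟨fun h => hne ?_, hdown T' hT'𝒟 T'' hT''⟩
        rw [h] at hT''
        exact (eq_of_subset_of_card_le hT'' (hTmax T' hT'𝒟)).symm)
    obtain ⟨i₁, hi₁, hi₁T⟩ := exists_of_ssubset hTss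
    have hi₁' : i₁ ∈ I₀ \ T := mem_sdiff.2 ⟨hi₁, hi₁T⟩
    obtain ⟨C₂, K₂, h₂⟩ := exists_degen_replace hi₀ hTss.1 hi₁' (hM T (card_le_card hTss.1))
      (hM _ (by
        refine (card_insert_le _ _).trans ?_
        rw [card_erase_add_one hi₁']
        exact card_le_card sdiff_subset)) (L + C₁) K₁ hβ
    refine ⟨C₁ + C₂, K₂, fun n G hG hGL => ?_⟩
    obtain ⟨G₁, hG₁, hG₁C, hG₁i, h₁⟩ := h₁ n G hG hGL
    obtain ⟨G₂, hG₂, hG₂C, hG₂i, h₂⟩ := h₂ n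
      (fun y => G y ∪ restrictForms {i₀} (update 0 i₀ y) G₁)
      (fun y => (hG y).union (valid_slice hi₀ hG₁ y))
      (fun y => (card_union_le _ _).trans (Nat.add_le_add (hGL y)
        ((card_restrictForms_le _ _).trans hG₁C)))
    refine ⟨G₁ ∪ G₂, hG₁.union hG₂, (card_union_le _ _).trans (Nat.add_le_add hG₁C hG₂C),
      fun g hg => (mem_union.1 hg).elim (hG₁i g) (hG₂i g), fun r hr hdense => ?_⟩
    obtain ⟨H₁, hH₁K, hH₁, hr₁⟩ := h₁ r hr hdense
    obtain ⟨x, hx, r', hr', hxr⟩ := Submodule.mem_sup.1 hr₁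
    obtain ⟨H₂, hH₂K, hH₂, hr₂⟩ := h₂ r' H₁ hH₁K (fun h hh => by
        obtain ⟨h1, h2, h3⟩ := hH₁ h hh
        refine ⟨h1, h2, fun h4 => ?_⟩
        by_contra h5
        exact h3 (mem_erase.2 ⟨h5, hdown T hT𝒟 _ h4⟩)) hr' (by
        refine hdense.trans ?_
        norm_cast
        refine card_le_card fun y hy => mem_filter.2 ⟨mem_univ _, ?_⟩
        have h1 := Submodule.sub_mem_sup (mem_filter.1 hy).2 (slice_mem_degen hi₀ hG₁ hG₁i y hx)
        rw [← map_sub, ← hxr, add_sub_cancel_left] at h1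
        rwa [degen_union])
    refine ⟨H₂, hH₂K, fun h hh => ?_, ?_⟩
    · obtain ⟨h1, h2, h3⟩ := hH₂ h hh
      refine ⟨h1, h2, fun h4 => ?_⟩
      rcases h3 with h3 | ⟨h3, h', hh', h5⟩
      · exact absurd (hTmax _ h4) (not_le.2 (card_lt_card h3))
      · exact (hH₁ h' hh').2.2 (mem_erase.2 ⟨h5 ▸ h3, h5 ▸ h4⟩)
    · rw [← hxr, degen_union, sup_assoc]
      exact Submodule.add_mem_sup hx hr₂

/-- If `r` has the axes `i₀` and `I₀`, and for most `y` in a dense weighted set its slice at `y`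
lies in a degenerate space given by boundedly many forms `G y`, then `r` lies in a degenerate
space that only depends on the `G y`. -/
lemma exists_degen_of_most_slices {I₀ : Finset (Fin d)} {i₀ : Fin d} (hi₀ : i₀ ∉ I₀)
    (hM : ∀ J : Finset (Fin d), J.card ≤ I₀.card → MostlyZeroDegenerate J) (L : ℕ) {δ : ℝ}
    (hδ : 0 < δ) :
    ∃ C : ℕ, ∀ (n : Fin d → ℕ) (G : (Fin (n i₀) → ZMod 2) → Finset (Form n)),
      (∀ y, Valid I₀ (G y)) → (∀ y, (G y).card ≤ L) →
      ∀ W : (Fin (n i₀) → ZMod 2) → ℝ, (∀ y, 0 ≤ W y) → (∀ y, W y ≤ 1) →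
        δ * Fintype.card (Fin (n i₀) → ZMod 2) ≤ ∑ y, W y →
      ∃ G' : Finset (Form n), Valid (insert i₀ I₀) G' ∧ G'.card ≤ C ∧
        ∀ r ∈ multilin n (insert i₀ I₀),
          ∑ y with slice i₀ y r ∉ degen I₀ (G y), W y ≤ 1 / 8 * ∑ y, W y →
          r ∈ degen (insert i₀ I₀) G' := by
  obtain ⟨C₁, K, h₁⟩ := exists_degen_iterate hi₀ hM L (β := δ / 2) (by positivity) _ I₀.ssubsets
    rfl subset_rfl fun T hT T' hT' =>
      mem_ssubsets.2 (lt_of_le_of_lt hT' (mem_ssubsets.1 hT))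
  obtain ⟨C₂, h₂⟩ := exists_degen_of_full hi₀ (hM I₀ le_rfl) (L + C₁) K hδ
  refine ⟨C₁ + C₂, fun n G hG hGL W hW0 hW1 hW => ?_⟩
  obtain ⟨G₁, hG₁, hG₁C, hG₁i, h₁⟩ := h₁ n G hG hGL
  obtain ⟨G₂, hG₂, hG₂C, h₂⟩ := h₂ n
    (fun y => G y ∪ restrictForms {i₀} (update 0 i₀ y) G₁)
    (fun y => (hG y).union (valid_slice hi₀ hG₁ y))
    (fun y => (card_union_le _ _).trans (Nat.add_le_add (hGL y)
      ((card_restrictForms_le _ _).trans hG₁C))) W hW0 hW1 hW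
  refine ⟨G₁ ∪ G₂, hG₁.union hG₂, (card_union_le _ _).trans (Nat.add_le_add hG₁C hG₂C),
    fun r hr hbad => ?_⟩
  have hdense : δ / 2 * Fintype.card (Fin (n i₀) → ZMod 2) ≤
      (univ.filter fun y => slice i₀ y r ∈ degen I₀ (G y)).card := by
    have h1 := sum_filter_add_sum_filter_not univ (fun y => slice i₀ y r ∈ degen I₀ (G y)) W
    have h2 : ∑ y with slice i₀ y r ∈ degen I₀ (G y), W y ≤
        (univ.filter fun y => slice i₀ y r ∈ degen I₀ (G y)).card := by
      refine (sum_le_sum fun y _ => hW1 y).trans ?_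
      simp
    have h3 : 0 ≤ δ * (Fintype.card (Fin (n i₀) → ZMod 2) : ℝ) := by positivity
    linarith
  obtain ⟨H, hHK, hH, hrH⟩ := h₁ r hr hdense
  obtain ⟨x, hx, r', hr', hxr⟩ := Submodule.mem_sup.1 hrH
  rw [← hxr, degen_union]
  refine Submodule.add_mem_sup hx (h₂ r' H hHK (fun h hh => ?_) hr' (le_trans ?_ hbad))
  · obtain ⟨h1, h2, h3⟩ := hH h hh
    refine ⟨?_, h2⟩
    by_contra h4
    exact h3 (mem_ssubsets.2 (h1.ssubset_of_ne h4))
  · refine sum_le_sum_of_subset_of_nonneg (fun y hy => ?_) fun y _ _ => hW0 y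
    refine mem_filter.2 ⟨mem_univ _, fun h => (mem_filter.1 hy).2 ?_⟩
    have h1 := Submodule.sub_mem_sup h (slice_mem_degen hi₀ hG₁ hG₁i y hx)
    rw [← map_sub, ← hxr, add_sub_cancel_left] at h1
    rwa [degen_union]

lemma mostlyZeroDegenerate_empty : MostlyZeroDegenerate (∅ : Finset (Fin d)) := by
  intro δ hδ
  refine ⟨0, fun n w hw0 _ hw => ⟨∅, by simp [Valid], by simp, fun r hr hsum => ?_⟩⟩
  have hpos : 0 < ∑ u, w u :=
    (mul_pos hδ (by exact_mod_cast Fintype.card_pos)).trans_le hw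
  have hconst : ∀ u, r u = r 0 := fun u => multilin_congr hr (by simp)
  have hr0 : r 0 = 0 := by
    by_contra hne
    rw [filter_true_of_mem fun u _ => by rwa [hconst u]] at hsum
    have : tol (∅ : Finset (Fin d)).card < 1 := by unfold tol; norm_num
    nlinarith
  have : r = 0 := funext fun u => (hconst u).trans hr0
  rw [this]
  exact Submodule.zero_mem _

/-- The inductive step: the degenerate spaces of the slices come from the case `I₀`, applied for
every `y` for which the weight is dense in the slice at `y`. -/
lemma mostlyZeroDegenerate_insert {I₀ : Finset (Fin d)} {i₀ : Fin d} (hi₀ : i₀ ∉ I₀)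
    (hM : ∀ J : Finset (Fin d), J.card ≤ I₀.card → MostlyZeroDegenerate J) :
    MostlyZeroDegenerate (insert i₀ I₀) := by
  intro δ hδ
  obtain ⟨L, hL⟩ := hM I₀ le_rfl (δ / 16) (by positivity)
  obtain ⟨C, hC⟩ := exists_degen_of_most_slices hi₀ hM L hδ
  refine ⟨C, fun n w hw0 hw1 hw => ?_⟩
  set N : ℝ := (Fintype.card (Tup n) : ℝ) with hN
  have hN0 : 0 < N := by rw [hN]; exact_mod_cast Fintype.card_pos
  set D : ℝ := (Fintype.card (Fin (n i₀) → ZMod 2) : ℝ) with hD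
  have hD0 : 0 < D := by rw [hD]; exact_mod_cast Fintype.card_pos
  let W : (Fin (n i₀) → ZMod 2) → ℝ := fun y => (∑ u, w (update u i₀ y)) / N
  have hW0 : ∀ y, 0 ≤ W y := fun y => div_nonneg (sum_nonneg fun u _ => hw0 _) hN0.le
  have hW1 : ∀ y, W y ≤ 1 := fun y => by
    rw [div_le_one hN0]
    refine (sum_le_sum fun u _ => hw1 _).trans ?_
    simp [hN]
  have hWsum : ∑ y, W y = D * (∑ u, w u) / N := by
    simp only [W]
    rw [← sum_div, sum_sum_update' i₀ w, nsmul_eq_mul]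
  have hWδ : δ * D ≤ ∑ y, W y := by
    rw [hWsum, le_div_iff₀ hN0]
    nlinarith
  have hchoose : ∀ y, ∃ G : Finset (Form n), Valid I₀ G ∧ G.card ≤ L ∧ (δ / 16 ≤ W y →
      ∀ r ∈ multilin n I₀, ∑ u with r u ≠ 0, w (update u i₀ y) ≤ tol I₀.card * (W y * N) →
        r ∈ degen I₀ G) := by
    intro y
    by_cases hy : δ / 16 ≤ W y
    · rw [le_div_iff₀ hN0] at hy
      obtain ⟨G, h1, h2, h3⟩ := hL n (fun u => w (update u i₀ y)) (fun u => hw0 _)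
        (fun u => hw1 _) hy
      refine ⟨G, h1, h2, fun _ r hr hsum => h3 r hr ?_⟩
      rwa [div_mul_cancel₀ _ hN0.ne'] at hsum
    · exact ⟨∅, by simp [Valid], by simp, fun h => absurd h hy⟩
  choose G hG hGL hGr using hchoose
  obtain ⟨G', hG', hG'C, hG'r⟩ := hC n G hG hGL W hW0 hW1 hWδ
  refine ⟨G', hG', hG'C, fun r hr hsum => hG'r r hr ?_⟩
  set ε := tol I₀.card with hε
  have hε0 : 0 < ε := tol_pos _
  have htol : tol (insert i₀ I₀).card = ε / 16 := by
    rw [hε, card_insert_of_notMem hi₀, tol, tol, pow_succ]; ring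
  rw [htol] at hsum
  let m : (Fin (n i₀) → ZMod 2) → ℝ := fun y =>
    ∑ u, if r (update u i₀ y) ≠ 0 then w (update u i₀ y) else 0
  have hm0 : ∀ y, 0 ≤ m y := fun y => sum_nonneg fun u _ => by
    split_ifs
    · exact hw0 _
    · exact le_rfl
  have hmsum : ∑ y, m y ≤ ε / 16 * (D * ∑ u, w u) := by
    have h1 := sum_sum_update' (n := n) i₀ fun u => if r u ≠ 0 then w u else 0
    rw [← sum_filter, nsmul_eq_mul] at h1
    have h2 := mul_le_mul_of_nonneg_left hsum hD0.le
    calc ∑ y, m y = D * ∑ u with r u ≠ 0, w u := h1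
      _ ≤ _ := by linarith
  have hbad : ∀ y ∈ univ.filter fun y => slice i₀ y r ∉ degen I₀ (G y),
      W y ≤ δ / 16 + m y / (ε * N) := by
    intro y hy
    by_contra! hlt
    have hpos : 0 ≤ m y / (ε * N) := div_nonneg (hm0 y) (by positivity)
    refine (mem_filter.1 hy).2 (hGr y (by linarith) _ ?_ ?_)
    · have := restrict_mem hr {i₀} (update 0 i₀ y)
      rwa [sdiff_singleton_eq_erase, erase_insert hi₀] at this
    · have h1 : m y / (ε * N) < W y := by linarith
      rw [div_lt_iff₀ (by positivity)] at h1
      simp only [slice_apply]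
      rw [sum_filter]
      calc m y ≤ W y * (ε * N) := h1.le
        _ = _ := by ring
  calc ∑ y with slice i₀ y r ∉ degen I₀ (G y), W y
      ≤ ∑ y with slice i₀ y r ∉ degen I₀ (G y), (δ / 16 + m y / (ε * N)) := sum_le_sum hbad
    _ ≤ ∑ y, (δ / 16 + m y / (ε * N)) :=
        sum_le_sum_of_subset_of_nonneg (subset_univ _) fun y _ _ =>
          add_nonneg (by positivity) (div_nonneg (hm0 y) (by positivity))
    _ = δ / 16 * D + (∑ y, m y) / (ε * N) := by
        rw [sum_add_distrib, sum_const, card_univ, nsmul_eq_mul, sum_div, mul_comm]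
    _ ≤ 1 / 16 * ∑ y, W y + ε / 16 * (D * ∑ u, w u) / (ε * N) := by
        have := div_le_div_of_nonneg_right hmsum (by positivity : 0 ≤ ε * N)
        linarith
    _ = 1 / 8 * ∑ y, W y := by
        rw [hWsum]; field_simp; ring

theorem mostlyZeroDegenerate (I : Finset (Fin d)) : MostlyZeroDegenerate I := by
  induction h : I.card using Nat.strong_induction_on generalizing I with
  | _ k ih =>
    rcases I.eq_empty_or_nonempty with rfl | ⟨i₀, hi₀⟩
    · exact mostlyZeroDegenerate_empty
    · rw [← insert_erase hi₀]
      refine mostlyZeroDegenerate_insert (notMem_erase _ _) fun J hJ => ih J.card ?_ J rfl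
      rw [card_erase_of_mem hi₀] at hJ
      have := card_pos.2 ⟨i₀, hi₀⟩
      omega

/-! ### Arrays as multilinear functions -/

/-- The multilinear function `u ↦ r.(u 1 ⊗ ⋯ ⊗ u d)` of an array `r`. -/
def toMultilin (r : Arrays n) : Tup n → ZMod 2 := fun u => r ⬝ᵥ pureTensor u

lemma toMultilin_mem (r : Arrays n) : toMultilin r ∈ multilin n univ := by
  refine ⟨fun u u' h => congrArg _ (funext fun i => h i (mem_univ i)), fun i _ u x y => ?_⟩
  simp only [toMultilin]
  rw [← dotProduct_add]
  congr 1
  funext z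
  simp only [pureTensor, Pi.add_apply]
  have key : ∀ v : Fin (n i) → ZMod 2, ∏ j, update u i v j (z j) =
      v (z i) * ∏ j ∈ univ.erase i, u j (z j) := fun v => by
    rw [← mul_prod_erase univ _ (mem_univ i), update_self]
    congr 1
    exact prod_congr rfl fun j hj => by rw [update_of_ne (ne_of_mem_erase hj)]
  rw [key, key, key, Pi.add_apply, add_mul]

/-- The tuple of standard basis vectors with a given index. -/
def basisTuple (x : (i : Fin d) → Fin (n i)) : Tup n := fun i => Pi.single (x i) 1

lemma toMultilin_basisTuple (r : Arrays n) (x : (i : Fin d) → Fin (n i)) :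
    toMultilin r (basisTuple x) = r x := by
  have h : pureTensor (basisTuple x) = Pi.single x (1 : ZMod 2) := by
    funext z
    by_cases hz : z = x
    · subst hz
      simp [pureTensor, basisTuple]
    · obtain ⟨i, hi⟩ := Function.ne_iff.1 hz
      rw [Pi.single_eq_of_ne hz, pureTensor]
      exact prod_eq_zero (mem_univ i) (Pi.single_eq_of_ne hi _)
  rw [toMultilin, h, dotProduct_single, mul_one]

/-- The array in `𝔽₂^I` of a function that is multilinear in the axes of `I`: its values at the
standard basis vectors. -/
noncomputable def toSubArray (I : Finset (Fin d)) (f : Tup n → ZMod 2) : SubArray n I :=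
  fun x => f fun i => if h : i ∈ I then Pi.single (x ⟨i, h⟩) 1 else 0

lemma toSubArray_apply {f : Tup n → ZMod 2} (hf : f ∈ multilin n I)
    (x : (i : Fin d) → Fin (n i)) : toSubArray I f (fun i => x i) = f (basisTuple x) :=
  multilin_congr hf fun i hi => by simp [hi, basisTuple]

lemma mem_iSup_tensorFull {G : Finset (Form n)} (hG : Valid univ G)
    {V : (I : Finset (Fin d)) → Submodule (ZMod 2) (SubArray n I)}
    (hV : ∀ g ∈ G, toSubArray g.1 g.2 ∈ V g.1) {r : Arrays n}
    (hr : toMultilin r ∈ degen univ G) :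
    r ∈ ⨆ (I : Finset (Fin d)) (_ : I.Nonempty), tensorFull (V I) := by
  obtain ⟨h, hh, he⟩ := mem_degen_iff.1 hr
  have hr' : r = ∑ g ∈ G, tensor (toSubArray g.1 g.2) (toSubArray g.1ᶜ (h g)) := by
    funext x
    rw [← toMultilin_basisTuple r x, he, Finset.sum_apply, Finset.sum_apply]
    refine sum_congr rfl fun g hg => ?_
    have hc : h g ∈ multilin n g.1ᶜ := by rw [compl_eq_univ_sdiff]; exact hh g
    rw [Pi.mul_apply, tensor, toSubArray_apply (hG g hg).2.2 x, toSubArray_apply hc x]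
  rw [hr']
  refine Submodule.sum_mem _ fun g hg => ?_
  refine Submodule.mem_iSup_of_mem g.1 (Submodule.mem_iSup_of_mem (hG g hg).2.1 ?_)
  exact Submodule.subset_span ⟨_, hV g hg, _, rfl⟩

lemma exists_le_of_le_map {α β : Type*} (f : α → β) (s : Multiset α) :
    ∀ t : Multiset β, t ≤ s.map f → ∃ s' ≤ s, s'.map f = t := by
  induction s using Multiset.induction_on with
  | empty => exact fun t ht => ⟨0, le_rfl, (Multiset.le_zero.1 ht).symm⟩
  | cons a s ih =>
    intro t ht
    rw [Multiset.map_cons] at ht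
    by_cases ha : f a ∈ t
    · obtain ⟨t', rfl⟩ := Multiset.exists_cons_of_mem ha
      obtain ⟨s', hs', rfl⟩ := ih t' ((Multiset.cons_le_cons_iff _).1 ht)
      exact ⟨a ::ₘ s', Multiset.cons_le_cons _ hs', Multiset.map_cons _ _ _⟩
    · obtain ⟨s', hs', rfl⟩ := ih t ((Multiset.le_cons_of_notMem ha).1 ht)
      exact ⟨s', hs'.trans (Multiset.le_cons_self _ _), rfl⟩

lemma exists_span_toSubArray (G : Finset (Form n)) :
    ∃ V : (I : Finset (Fin d)) → Submodule (ZMod 2) (SubArray n I),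
      (∀ I, Module.finrank (ZMod 2) (V I) ≤ G.card) ∧ ∀ g ∈ G, toSubArray g.1 g.2 ∈ V g.1 := by
  let S : (I : Finset (Fin d)) → Finset (SubArray n I) := fun I =>
    (G.filter fun g => g.1 = I).image fun g => toSubArray I g.2
  refine ⟨fun I => Submodule.span (ZMod 2) (S I : Set (SubArray n I)), fun I => ?_,
    fun g hg => Submodule.subset_span ?_⟩
  · exact (finrank_span_finset_le_card _).trans (card_image_le.trans (card_filter_le _ _))
  · exact mem_coe.2 (mem_image.2 ⟨g, mem_filter.2 ⟨hg, rfl⟩, rfl⟩)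

lemma card_filter_dotProduct (P : Finset (Tup n)) (r : Arrays n) :
    ((P.val.map pureTensor).filter fun q => r ⬝ᵥ q = 0).card +
      (P.filter fun u => toMultilin r u ≠ 0).card = P.card := by
  rw [Multiset.filter_map, Multiset.card_map]
  exact card_filter_add_card_filter_not (s := P) fun u => toMultilin r u = 0

/-- The set `B'` itself serves as `Q`: no sums of elements of `B'` are needed. -/
lemma exists_subspaces (d : ℕ) {δ : ℝ} (hδ : 0 < δ) :
    ∃ C : ℕ, ∀ (n : Fin d → ℕ) (B' : Multiset (Arrays n)), B' ≤ rankOneMultiset n →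
      δ * ((rankOneMultiset n).card : ℝ) ≤ (B'.card : ℝ) →
      ∃ V : (I : Finset (Fin d)) → Submodule (ZMod 2) (SubArray n I),
        (∀ I, Module.finrank (ZMod 2) (V I) ≤ C) ∧
        ∀ r : Arrays n,
          (1 - tol d) * (B'.card : ℝ) ≤ ((B'.filter fun q => r ⬝ᵥ q = 0).card : ℝ) →
          r ∈ ⨆ (I : Finset (Fin d)) (_ : I.Nonempty), tensorFull (V I) := by
  obtain ⟨C, hC⟩ := mostlyZeroDegenerate (univ : Finset (Fin d)) δ hδ
  rw [card_univ, Fintype.card_fin] at hC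
  refine ⟨C, fun n B' hB' hcard => ?_⟩
  obtain ⟨s, hs, rfl⟩ := exists_le_of_le_map _ _ _ hB'
  obtain ⟨P, rfl⟩ : ∃ P : Finset (Tup n), P.val = s :=
    ⟨⟨s, Multiset.nodup_of_le hs univ.nodup⟩, rfl⟩
  have hsum : ∑ u : Tup n, (if u ∈ P then (1 : ℝ) else 0) = P.card := by
    rw [sum_boole, filter_mem_eq_inter, univ_inter]
  obtain ⟨G, hG, hGC, hGr⟩ := hC n (fun u => if u ∈ P then 1 else 0)
    (fun u => by split_ifs <;> simp) (fun u => by split_ifs <;> simp) (by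
      rw [hsum]
      simpa only [rankOneMultiset, Multiset.card_map, card_val, card_univ] using hcard)
  obtain ⟨V, hV, hVG⟩ := exists_span_toSubArray G
  refine ⟨V, fun I => (hV I).trans hGC, fun r hr => ?_⟩
  refine mem_iSup_tensorFull hG hVG (hGr _ (toMultilin_mem r) ?_)
  have h1 : ∑ u : Tup n with toMultilin r u ≠ 0, (if u ∈ P then (1 : ℝ) else 0) =
      (P.filter fun u => toMultilin r u ≠ 0).card := by
    rw [sum_boole, filter_filter]
    congr 2
    ext u; simp [and_comm]
  have h2 : (((P.val.map pureTensor).filter fun q => r ⬝ᵥ q = 0).card : ℝ) +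
      (P.filter fun u => toMultilin r u ≠ 0).card = P.card := by
    exact_mod_cast card_filter_dotProduct P r
  rw [Multiset.card_map, card_val] at hr
  rw [h1, hsum]
  linarith

end GowersJanzer

theorem lemma2p1 :
    ∃ (f₁ : ℕ → ℕ) (f₂ : ℕ → ℝ → ℕ) (f₃ : ℕ → ℝ),
      (∀ d, 0 < f₁ d) ∧ (∀ d, 0 < f₃ d) ∧
      ∀ (d : ℕ) (δ : ℝ), 0 < δ →
        ∀ (n : Fin d → ℕ) (B' : Multiset (GowersJanzer.Arrays n)),
          B' ≤ GowersJanzer.rankOneMultiset n →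
          δ * ((GowersJanzer.rankOneMultiset n).card : ℝ) ≤ (B'.card : ℝ) →
          ∃ Q : Multiset (GowersJanzer.Arrays n),
            (∀ q ∈ Q, q ∈ GowersJanzer.sumsOfAtMost (f₁ d) B') ∧
            ∃ V : (I : Finset (Fin d)) → Submodule (ZMod 2) (GowersJanzer.SubArray n I),
              (∀ I : Finset (Fin d), I.Nonempty → Module.finrank (ZMod 2) (V I) ≤ f₂ d δ) ∧
              ∀ r : GowersJanzer.Arrays n,
                (1 - f₃ d) * (Q.card : ℝ) ≤ ((Q.filter fun q => r ⬝ᵥ q = 0).card : ℝ) →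
                r ∈ ⨆ (I : Finset (Fin d)) (_ : I.Nonempty), GowersJanzer.tensorFull (V I) := by
  classical
  refine ⟨fun _ => 1,
    fun d δ => if hδ : 0 < δ then (GowersJanzer.exists_subspaces d hδ).choose else 0,
    GowersJanzer.tol, fun _ => one_pos, GowersJanzer.tol_pos, fun d δ hδ n B' hB' hcard =>
      ⟨B', fun q hq => ⟨{q}, by simp, by simpa using hq, by simp⟩, ?_⟩⟩
  obtain ⟨V, hV, hr⟩ := (GowersJanzer.exists_subspaces d hδ).choose_spec n B' hB' hcard
  exact ⟨V, fun I _ => by beta_reduce; rw [dif_pos hδ]; exact hV I, hr⟩
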